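/- **Theorem 3.1 (Local quadratic bracketing).** Setting. Let $p\ge 1$, $\Theta\subseteq\mathbb R^p$, let $\theta^*$ be an interior point of $\Theta$, and let $L(\theta)$, $\theta\in\Theta$, be a real random process on a probability space $(\Omega,\mathcal F,P)$ (the quasi-log-likelihood) with $E|L(\theta)|<\infty$. Put $L(\theta,\theta^*)=L(\theta)-L(\theta^*)$ and $\zeta(\theta)=L(\theta)-EL(\theta)$. Let $V_0^2,D_0^2$ be symmetric positive definite $p\times p$ matrices with symmetric positive definite square roots $V_0,D_0$, let $\nu_0\ge1$, $\mathtt g>0$, and for $r>0$ put $$\Theta_0(r)=\{\theta\in\Theta:\ \|V_0(\theta-\theta^*)\|\le r\}.$$ Let $r^*>0$ be fixed. The conditions are: * $(ED_1)$: for each $0<r\le r^*$ there is a constant $0<\rho(r)\le 1/2$ such that for all $\theta\in\Theta_0(r)$ and all $|\lambda|\le\mathtt g$ $$\sup_{\gamma\ne0}\ \log E\exp\Bigl\{\lambda\,\frac{\gamma^\top(\nabla\zeta(\theta)-\nabla\zeta(\theta^*))}{\rho(r)\,\|V_0\gamma\|}\Bigr\}\le \nu_0^2\lambda^2/2 .$$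 * $(\mathcal L_0)$: for each $0<r\le r^*$ there is a constant $\delta(r)\le 1/2$ such that for all $\theta\in\Theta_0(r)$, $\theta\ne\theta^*$, $$\Bigl|\frac{-2\,EL(\theta,\theta^*)}{\|D_0(\theta-\theta^*)\|^2}-1\Bigr|\le\delta(r).$$ For $\mathfrak d=(\delta,\omega)$ let $D_{\mathfrak d}^2=D_0^2(1-\delta)-\omega V_0^2$, let $D_{\mathfrak d}$ be its nonnegative symmetric square root (when $D_{\mathfrak d}^2\ge0$), and $$\mathbb L_{\mathfrak d}(\theta,\theta^*)=(\theta-\theta^*)^\top\nabla L(\theta^*)-\|D_{\mathfrak d}(\theta-\theta^*)\|^2/2 ;$$ the index $-\mathfrak d=(-\delta,-\omega)$ gives $D_{-\mathfrak d}^2=D_0^2(1+\delta)+\omega V_0^2$ and $\mathbb L_{-\mathfrak d}$. Define the error terms, with values in the extended reals, by $$\diamondsuit_{\pm\mathfrak d}(r)=\sup_{\theta\in\Theta_0(r)}\Bigl\{\pm\bigl[L(\theta,\theta^*)-EL(\theta,\theta^*)-(\theta-\theta^*)^\top\nabla L(\theta^*)\bigr]-\frac{\omega}{2}\|V_0(\theta-\theta^*)\|^2\Bigr\}.$$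 Statement. Assume $(ED_1)$ and $(\mathcal L_0)$. Let $0<r\le r^*$ be such that $\Theta_0(r)$ is convex (for example, the full ellipsoid) and, for every outcome, $\zeta$ is differentiable at every point of $\Theta_0(r)$. Let $\omega\ge3\nu_0\rho(r)$ and $\delta\ge\delta(r)$ be such that $D_0^2(1-\delta)-\omega V_0^2\ge0$. Then: 1. For every outcome and all $\theta\in\Theta_0(r)$, $$\mathbb L_{-\mathfrak d}(\theta,\theta^*)-\diamondsuit_{-\mathfrak d}(r)\ \le\ L(\theta,\theta^*)\ \le\ \mathbb L_{\mathfrak d}(\theta,\theta^*)+\diamondsuit_{\mathfrak d}(r).$$ 2. The two processes have the structure of log-likelihood ratios of linear Gaussian models: with $\xi_{\pm\mathfrak d}=D_{\pm\mathfrak d}^{-1}\nabla L(\theta^*)$, for every outcome and all $\theta\in\mathbb R^p$, $$\mathbb L_{\pm\mathfrak d}(\theta,\theta^*)=\xi_{\pm\mathfrak d}^\top D_{\pm\mathfrak d}(\theta-\theta^*)-\|D_{\pm\mathfrak d}(\theta-\theta^*)\|^2/2 ,$$ where $D_{-\mathfrak d}^2$ is always positive definite, and for the index $+\mathfrak d$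 the identity is asserted whenever $D_{\mathfrak d}^2$ is positive definite. 3. The errors $\diamondsuit_{\mathfrak d}(r)$ and $\diamondsuit_{-\mathfrak d}(r)$ are nonnegative and almost surely finite, and if $\mathtt g_0:=\mathtt g\nu_0\ge3$, then for all $x\ge0$ $$P\{\omega^{-1}\diamondsuit_{\mathfrak d}(r)\ge \mathfrak z(x,Q)\}\le e^{-x},\qquad P\{\omega^{-1}\diamondsuit_{-\mathfrak d}(r)\ge \mathfrak z(x,Q)\}\le e^{-x},$$ where $Q=2p$ for $p\ge2$, $Q=2.7$ for $p=1$, and $$\mathfrak z(x,Q)=\begin{cases}(1+\sqrt{x+Q})^2,&1+\sqrt{x+Q}\le\mathtt g_0,\\ 1+\{2\mathtt g_0^{-1}(x+Q)+\mathtt g_0\}^2,&\text{otherwise.}\end{cases}$$ -/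

import Mathlib

open MeasureTheory ProbabilityTheory
open scoped RealInnerProductSpace MatrixOrder

namespace Bracketing

noncomputable section

/-- The parameter space `ℝ^p` with its Euclidean norm. -/
abbrev Param (p : ℕ) : Type := EuclideanSpace ℝ (Fin p)

/-- `app A h` is the matrix-vector product `A h` in Euclidean space. -/
def app {p : ℕ} (A : Matrix (Fin p) (Fin p) ℝ) (h : Param p) : Param p :=
  Matrix.toEuclideanCLM (𝕜 := ℝ) A h

/-- The local elliptic set `Θ₀(r) = {θ ∈ Θ : ‖V (θ - θ*)‖ ≤ r}`. -/
def localSet {p : ℕ} (Θ : Set (Param p)) (θs : Param p) (V : Matrix (Fin p) (Fin p) ℝ)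
    (r : ℝ) : Set (Param p) :=
  {θ | θ ∈ Θ ∧ ‖app V (θ - θs)‖ ≤ r}

section Quasi

variable {p : ℕ} {Ω : Type*} [MeasurableSpace Ω]

/-- The expected log-likelihood `E L(θ)`. -/
def meanL (P : Measure Ω) (L : Param p → Ω → ℝ) (θ : Param p) : ℝ :=
  ∫ ω, L θ ω ∂P

/-- The stochastic component `ζ(θ) = L(θ) - E L(θ)`. -/
def zeta (P : Measure Ω) (L : Param p → Ω → ℝ) (θ : Param p) (ω : Ω) : ℝ :=
  L θ ω - meanL P L θ

/-- The gradient in `θ` of the stochastic component, `∇ζ(θ)`. -/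
def gradZeta (P : Measure Ω) (L : Param p → Ω → ℝ) (θ : Param p) (ω : Ω) : Param p :=
  gradient (fun θ' => zeta P L θ' ω) θ

/-- The gradient of the log-likelihood at `θ`, `∇L(θ)`. -/
def gradL (L : Param p → Ω → ℝ) (θ : Param p) (ω : Ω) : Param p :=
  gradient (fun θ' => L θ' ω) θ

/-- The log-likelihood ratio `L(θ, θ*) = L(θ) - L(θ*)`. -/
def llr (L : Param p → Ω → ℝ) (θ θs : Param p) (ω : Ω) : ℝ :=
  L θ ω - L θs ω

/-- Condition `(ED₁)`: for each `r ≤ r*` the constant `ρ(r) ∈ (0, 1/2]` is such that, for all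
`θ ∈ Θ₀(r)`, all `γ ≠ 0` and all `|t| ≤ g`,
`log E exp {t γᵀ(∇ζ(θ) - ∇ζ(θ*)) / (ρ(r) ‖V γ‖)} ≤ ν² t² / 2`.
The integrability clause says that the exponential moment is finite. -/
def CondED1 (P : Measure Ω) (Θ : Set (Param p)) (θs : Param p) (L : Param p → Ω → ℝ)
    (V : Matrix (Fin p) (Fin p) ℝ) (ν g rs : ℝ) (ρ : ℝ → ℝ) : Prop :=
  ∀ r : ℝ, 0 < r → r ≤ rs →
    0 < ρ r ∧ ρ r ≤ 1 / 2 ∧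
    ∀ θ ∈ localSet Θ θs V r, ∀ γ : Param p, γ ≠ 0 → ∀ t : ℝ, |t| ≤ g →
      Integrable (fun ω => Real.exp
        (t * (⟪γ, gradZeta P L θ ω - gradZeta P L θs ω⟫ / (ρ r * ‖app V γ‖)))) P ∧
      cgf (fun ω => ⟪γ, gradZeta P L θ ω - gradZeta P L θs ω⟫ / (ρ r * ‖app V γ‖)) P t
        ≤ ν ^ 2 * t ^ 2 / 2

/-- Condition `(L₀)` (local identifiability): for each `r ≤ r*` the constant `δ(r) ≤ 1/2` is such
that `|-2 E L(θ, θ*) / ‖D (θ - θ*)‖² - 1| ≤ δ(r)` for all `θ ∈ Θ₀(r)`, `θ ≠ θ*`. -/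
def CondL0 (P : Measure Ω) (Θ : Set (Param p)) (θs : Param p) (L : Param p → Ω → ℝ)
    (V D : Matrix (Fin p) (Fin p) ℝ) (rs : ℝ) (δr : ℝ → ℝ) : Prop :=
  ∀ r : ℝ, 0 < r → r ≤ rs →
    δr r ≤ 1 / 2 ∧
    ∀ θ ∈ localSet Θ θs V r, θ ≠ θs →
      |(-2 * ∫ ω, llr L θ θs ω ∂P) / ‖app D (θ - θs)‖ ^ 2 - 1| ≤ δr r

/-- The matrix `D_ε² = D² (1 - δ) - w V²` for `ε = (δ, w)`; the matrix for `-ε` is obtained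
from the pair `(-δ, -w)`. -/
def DepsSq (D V : Matrix (Fin p) (Fin p) ℝ) (δ w : ℝ) : Matrix (Fin p) (Fin p) ℝ :=
  (1 - δ) • (D * D) - w • (V * V)

/-- The matrix `D_ε`: the nonnegative symmetric square root of `D_ε²`. -/
def Deps (D V : Matrix (Fin p) (Fin p) ℝ) (δ w : ℝ) : Matrix (Fin p) (Fin p) ℝ :=
  CFC.sqrt (DepsSq D V δ w)

/-- The quadratic process
`𝕃_ε(θ, θ*) = (θ - θ*)ᵀ ∇L(θ*) - ‖D_ε (θ - θ*)‖² / 2`, `ε = (δ, w)`. -/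
def quadProc (L : Param p → Ω → ℝ) (D V : Matrix (Fin p) (Fin p) ℝ) (δ w : ℝ)
    (θ θs : Param p) (ω : Ω) : ℝ :=
  ⟪θ - θs, gradL L θs ω⟫ - ‖app (Deps D V δ w) (θ - θs)‖ ^ 2 / 2

/-- The standardized score `ξ_ε = D_ε⁻¹ ∇L(θ*)`. -/
def xi (L : Param p → Ω → ℝ) (D V : Matrix (Fin p) (Fin p) ℝ) (δ w : ℝ)
    (θs : Param p) (ω : Ω) : Param p :=
  app (Deps D V δ w)⁻¹ (gradL L θs ω)

/-- The upper error `♦_ε(r)`: the supremum over `θ ∈ Θ₀(r)` of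
`L(θ,θ*) - E L(θ,θ*) - (θ - θ*)ᵀ ∇L(θ*) - (w/2) ‖V (θ - θ*)‖²`,
an extended real number. -/
def errUpper (P : Measure Ω) (Θ : Set (Param p)) (θs : Param p) (L : Param p → Ω → ℝ)
    (V : Matrix (Fin p) (Fin p) ℝ) (w r : ℝ) (ω : Ω) : EReal :=
  ⨆ θ ∈ localSet Θ θs V r,
    ((llr L θ θs ω - ∫ ω', llr L θ θs ω' ∂P - ⟪θ - θs, gradL L θs ω⟫
      - w / 2 * ‖app V (θ - θs)‖ ^ 2 : ℝ) : EReal)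

/-- The lower error `♦_{-ε}(r)`: the supremum over `θ ∈ Θ₀(r)` of
`-{L(θ,θ*) - E L(θ,θ*) - (θ - θ*)ᵀ ∇L(θ*)} - (w/2) ‖V (θ - θ*)‖²`,
an extended real number. -/
def errLower (P : Measure Ω) (Θ : Set (Param p)) (θs : Param p) (L : Param p → Ω → ℝ)
    (V : Matrix (Fin p) (Fin p) ℝ) (w r : ℝ) (ω : Ω) : EReal :=
  ⨆ θ ∈ localSet Θ θs V r,
    ((-(llr L θ θs ω - ∫ ω', llr L θ θs ω' ∂P - ⟪θ - θs, gradL L θs ω⟫)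
      - w / 2 * ‖app V (θ - θs)‖ ^ 2 : ℝ) : EReal)

end Quasi

/-- The entropy constant `Q = c₁ p`, with `c₁ = 2` for `p ≥ 2` and `c₁ = 2.7` for `p = 1`. -/
def entropyConst (p : ℕ) : ℝ := (if p = 1 then 2.7 else 2) * (p : ℝ)

/-- The quantile function `z(x, Q)`, depending on the constant `g₀`. -/
def zQ (g₀ x Q : ℝ) : ℝ :=
  if 1 + Real.sqrt (x + Q) ≤ g₀ then (1 + Real.sqrt (x + Q)) ^ 2
  else 1 + (2 * g₀⁻¹ * (x + Q) + g₀) ^ 2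

end

end Bracketing

/-!
Near the interior point `θs`, the difference `E L(θ) - E L(θs)` is `-‖D₀(θ - θs)‖² / 2` up to a
factor in `[1 - δ, 1 + δ]`, so the gradient of `E L` vanishes at `θs`. Hence `∇L(θs) = ∇ζ(θs)`, and
the error terms are penalized suprema of `±` the Taylor remainder
`ζ(θ) - ζ(θs) - (θ - θs)ᵀ ∇ζ(θs)`.

By Jensen's inequality along segments, the condition on `∇ζ(θ) - ∇ζ(θs)` makes the increments of
this remainder sub-Gaussian for the seminorm `‖V₀ ·‖`. Its supremum over a convex set of
`V₀`-radius `R` is controlled by chaining. The `k`-th approximation of the field at `w` is its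
mean over the homothetic copy of the set with centre `w` and ratio `3⁻ᵏ`. One more Jensen
inequality bounds the exponential of an increment between successive approximations by a
`w`-independent integral, at the price of the density `3^{(k + 1) p}` of the small copy with
respect to the whole. With weights proportional to the link lengths, the total entropy is
`(7 / 4) p log 3 ≤ 2 p`.

The quadratic penalty is handled by peeling: on the shell of radius `2 a (7 / 5)ʲ`, `j ∈ ℤ`, the
field has to exceed `3 a² (1 + (7 / 5)²ʲ)`, and the probabilities of these events are summed over
`j`.
-/

namespace Bracketing

open Filter Topology

section Chaining

theorem integrable_of_continuous {C : Type*} [TopologicalSpace C] [CompactSpace C]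
    [MeasurableSpace C] [OpensMeasurableSpace C] {μ : Measure C} [IsFiniteMeasure μ] {f : C → ℝ}
    (hf : Continuous f) : Integrable f μ :=
  hf.integrable_of_hasCompactSupport (HasCompactSupport.of_compactSpace f)

/-- A chain of averages on a probability space `(C, μ)`, along which a continuous function is
compared with its value at the root `o`: the `k`-th approximation of `w` averages over the points
`link k w u`, `u` distributed according to `μ`, which concentrate at `w` as `k → ∞`. The law of
`link (k + 1) w u` has density at most `exp (entropy k)` with respect to `μ`. -/
structure AveragingChain {C : Type*} [TopologicalSpace C] [MeasurableSpace C] (μ : Measure C)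
    (o : C) where
  link : ℕ → C → C → C
  entropy : ℕ → ℝ
  link_zero : ∀ w u, link 0 w u = o
  continuous_link : ∀ k, Continuous fun q : C × C => link k q.1 q.2
  tendsto_link : ∀ w u, Tendsto (fun k => link k w u) atTop (𝓝 w)
  map_link_succ_le : ∀ k w,
    μ.map (link (k + 1) w) ≤ ENNReal.ofReal (Real.exp (entropy k)) • μ

namespace AveragingChain

variable {C : Type*} [TopologicalSpace C] [MeasurableSpace C] {μ : Measure C} {o : C}
  (chain : AveragingChain μ o)

/-- The `k`-th approximation of the function `z` along the chain. -/
noncomputable def average (z : C → ℝ) (k : ℕ) (w : C) : ℝ := ∫ u, z (chain.link k w u) ∂μ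

/-- The increment of `z` over the `k`-th link of the chain. -/
def increment (z : C → ℝ) (k : ℕ) (q : C × C) : ℝ := z q.1 - z (chain.link k q.1 q.2)

variable {z : C → ℝ}

theorem continuous_increment (hz : Continuous z) (k : ℕ) : Continuous (chain.increment z k) :=
  (hz.comp continuous_fst).sub (hz.comp (chain.continuous_link k))

theorem continuous_link_right (k : ℕ) (w : C) : Continuous (chain.link k w) :=
  (chain.continuous_link k).comp (Continuous.prodMk_right w)

theorem average_zero [IsProbabilityMeasure μ] (w : C) : chain.average z 0 w = z o := by
  simp [average, chain.link_zero]

variable [BorelSpace C]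

section RandomField

variable {Ω : Type*} {Z : C → Ω → ℝ}

/-- The random variable dominating `exp (l * Z w - Q)` for all `w` simultaneously, where `Q` is the
`p`-average of the entropies of the chain. -/
noncomputable def envelope (Z : C → Ω → ℝ) (p : ℕ → ℝ) (l : ℝ) (ω : Ω) : ENNReal :=
  ∑' k, ENNReal.ofReal (p k) * ∫⁻ q, ENNReal.ofReal
    (Real.exp (l / p k * chain.increment (Z · ω) k q)) ∂(μ.prod μ)

variable [MeasurableSpace Ω] [TopologicalSpace.MetrizableSpace C] [SecondCountableTopology C]

theorem measurable_exp_increment (hZc : ∀ ω, Continuous (Z · ω)) (hZm : ∀ c, Measurable (Z c))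
    (t : ℝ) (k : ℕ) : Measurable fun x : Ω × C × C =>
      ENNReal.ofReal (Real.exp (t * chain.increment (Z · x.1) k x.2)) := by
  have hZ : Measurable fun x : C × Ω => Z x.1 x.2 :=
    measurable_uncurry_of_continuous_of_measurable hZc hZm
  exact (((hZ.comp (measurable_snd.fst.prodMk measurable_fst)).sub
    (hZ.comp (((chain.continuous_link k).measurable.comp measurable_snd).prodMk
      measurable_fst))).const_mul t).exp.ennreal_ofReal

variable [IsProbabilityMeasure μ]

theorem measurable_envelope (hZc : ∀ ω, Continuous (Z · ω)) (hZm : ∀ c, Measurable (Z c))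
    (p : ℕ → ℝ) (l : ℝ) : Measurable (chain.envelope Z p l) :=
  Measurable.tsum fun k =>
    (chain.measurable_exp_increment hZc hZm (l / p k) k).lintegral_prod_right'.const_mul _

theorem lintegral_envelope_le {P : Measure Ω} [SFinite P] (hZc : ∀ ω, Continuous (Z · ω))
    (hZm : ∀ c, Measurable (Z c)) {p : ℕ → ℝ} (hp : ∀ k, 0 ≤ p k) (hsum : HasSum p 1) {l : ℝ}
    {M : ENNReal} (hM : ∀ k b u, ∫⁻ ω, ENNReal.ofReal
      (Real.exp (l / p k * (Z b ω - Z (chain.link k b u) ω))) ∂P ≤ M) :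
    ∫⁻ ω, chain.envelope Z p l ω ∂P ≤ M := by
  have hmeas (k : ℕ) := chain.measurable_exp_increment hZc hZm (l / p k) k
  have hterm (k : ℕ) : ∫⁻ ω, ∫⁻ q, ENNReal.ofReal
      (Real.exp (l / p k * chain.increment (Z · ω) k q)) ∂(μ.prod μ) ∂P ≤ M := by
    rw [lintegral_lintegral_swap (hmeas k).aemeasurable]
    calc _ ≤ ∫⁻ _, M ∂(μ.prod μ) := lintegral_mono fun q => hM k q.1 q.2
      _ = M := by simp
  calc ∫⁻ ω, chain.envelope Z p l ω ∂P
      = ∑' k, ENNReal.ofReal (p k) * ∫⁻ ω, ∫⁻ q, ENNReal.ofReal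
          (Real.exp (l / p k * chain.increment (Z · ω) k q)) ∂(μ.prod μ) ∂P := by
        simp only [envelope]
        rw [lintegral_tsum fun k => ((hmeas k).lintegral_prod_right'.const_mul _).aemeasurable]
        exact tsum_congr fun k => lintegral_const_mul _ (hmeas k).lintegral_prod_right'
    _ ≤ ∑' k, ENNReal.ofReal (p k) * M := ENNReal.tsum_le_tsum fun k => by gcongr; exact hterm k
    _ = M := by
        rw [ENNReal.tsum_mul_right, ← ENNReal.ofReal_tsum_of_nonneg hp hsum.summable, hsum.tsum_eq,
          ENNReal.ofReal_one, one_mul]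

end RandomField

variable [CompactSpace C]

theorem tendsto_average [IsProbabilityMeasure μ] (hz : Continuous z) (w : C) :
    Tendsto (fun k => chain.average z k w) atTop (𝓝 (z w)) := by
  obtain ⟨b, hb⟩ := isCompact_univ.exists_bound_of_continuousOn hz.continuousOn
  have hlim : Tendsto (fun k => chain.average z k w) atTop (𝓝 (∫ _, z w ∂μ)) :=
    tendsto_integral_of_dominated_convergence (fun _ => b)
      (fun k => (hz.comp (chain.continuous_link_right k w)).aestronglyMeasurable)
      (integrable_const b) (fun k => ae_of_all _ fun u => hb _ (Set.mem_univ _))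
      (ae_of_all _ fun u => (hz.tendsto w).comp (chain.tendsto_link w u))
  simpa using hlim

variable [TopologicalSpace.MetrizableSpace C] [IsProbabilityMeasure μ]

theorem continuous_average (hz : Continuous z) (k : ℕ) : Continuous (chain.average z k) := by
  have hcont := continuous_parametric_integral_of_continuous (μ := μ)
    (f := fun w u => z (chain.link k w u)) (hz.comp (chain.continuous_link k)) isCompact_univ
  rwa [Measure.restrict_univ] at hcont

variable [SecondCountableTopology C]

theorem integral_increment (hz : Continuous z) (k : ℕ) (w : C) :
    ∫ q, chain.increment z k q ∂((μ.map (chain.link (k + 1) w)).prod μ)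
      = chain.average z (k + 1) w - ∫ u, chain.average z k (chain.link (k + 1) w u) ∂μ := by
  have hm := (chain.continuous_link_right (k + 1) w).measurable
  have := Measure.isProbabilityMeasure_map (μ := μ) hm.aemeasurable
  have hfst : Continuous fun q : C × C => z q.1 := hz.comp continuous_fst
  have hlink : Continuous fun q : C × C => z (chain.link k q.1 q.2) :=
    hz.comp (chain.continuous_link k)
  simp only [increment]
  rw [integral_sub (integrable_of_continuous hfst) (integrable_of_continuous hlink),
    integral_fun_fst z, integral_prod _ (integrable_of_continuous hlink), probReal_univ, one_smul,
    integral_map hm.aemeasurable hz.aestronglyMeasurable]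
  congr 1
  exact integral_map hm.aemeasurable (chain.continuous_average hz k).aestronglyMeasurable

theorem mul_average_sub_le (hz : Continuous z) (t : ℝ) (k : ℕ) (w : C) :
    t * (chain.average z (k + 1) w - ∫ u, chain.average z k (chain.link (k + 1) w u) ∂μ)
      ≤ chain.entropy k + cgf (chain.increment z k) (μ.prod μ) t := by
  have hm := (chain.continuous_link_right (k + 1) w).measurable
  have := Measure.isProbabilityMeasure_map (μ := μ) hm.aemeasurable
  set law := (μ.map (chain.link (k + 1) w)).prod μ with hlaw
  have hcont : Continuous fun q => t * chain.increment z k q :=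
    (chain.continuous_increment hz k).const_mul t
  have hdom : law ≤ ENNReal.ofReal (Real.exp (chain.entropy k)) • μ.prod μ := by
    rw [hlaw, ← Measure.prod_smul_left]
    exact Measure.prod_mono (chain.map_link_succ_le k w) le_rfl
  have hint : Integrable (fun q => Real.exp (t * chain.increment z k q)) (μ.prod μ) :=
    integrable_of_continuous hcont.rexp
  rw [← Real.exp_le_exp, Real.exp_add, exp_cgf hint, ← chain.integral_increment hz,
    ← integral_const_mul]
  calc Real.exp (∫ q, t * chain.increment z k q ∂law)
      ≤ ∫ q, Real.exp (t * chain.increment z k q) ∂law :=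
        convexOn_exp.map_integral_le Real.continuous_exp.continuousOn isClosed_univ
          (ae_of_all _ fun _ => Set.mem_univ _) (integrable_of_continuous hcont)
          (integrable_of_continuous hcont.rexp)
    _ ≤ ∫ q, Real.exp (t * chain.increment z k q)
          ∂(ENNReal.ofReal (Real.exp (chain.entropy k)) • μ.prod μ) :=
        integral_mono_measure hdom (ae_of_all _ fun _ => (Real.exp_pos _).le)
          (hint.smul_measure ENNReal.ofReal_ne_top)
    _ = Real.exp (chain.entropy k) * mgf (chain.increment z k) (μ.prod μ) t := by
        rw [integral_smul_measure, ENNReal.toReal_ofReal (Real.exp_pos _).le, smul_eq_mul, mgf]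

theorem mul_average_le (hz : Continuous z) (ho : z o = 0) {p : ℕ → ℝ} (hp : ∀ k, 0 < p k)
    (l : ℝ) (n : ℕ) (w : C) :
    l * chain.average z n w ≤ ∑ k ∈ Finset.range n,
      p k * (chain.entropy k + cgf (chain.increment z k) (μ.prod μ) (l / p k)) := by
  induction n generalizing w with
  | zero => simp [average_zero, ho]
  | succ n ih =>
    rw [Finset.sum_range_succ]
    have hlink : l * (chain.average z (n + 1) w
        - ∫ u, chain.average z n (chain.link (n + 1) w u) ∂μ)
        ≤ p n * (chain.entropy n + cgf (chain.increment z n) (μ.prod μ) (l / p n)) := by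
      refine le_trans (le_of_eq ?_)
        (mul_le_mul_of_nonneg_left (chain.mul_average_sub_le hz (l / p n) n w) (hp n).le)
      rw [← mul_assoc, mul_div_cancel₀ _ (hp n).ne']
    have hprev : l * ∫ u, chain.average z n (chain.link (n + 1) w u) ∂μ ≤ ∑ k ∈ Finset.range n,
        p k * (chain.entropy k + cgf (chain.increment z k) (μ.prod μ) (l / p k)) := by
      have hcont : Continuous fun u => l * chain.average z n (chain.link (n + 1) w u) :=
        ((chain.continuous_average hz n).comp (chain.continuous_link_right _ w)).const_mul l
      rw [← integral_const_mul]
      simpa using integral_mono (integrable_of_continuous hcont) (integrable_const (μ := μ) _)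
        fun u => ih (chain.link (n + 1) w u)
    linarith

theorem exp_mul_sub_le_of_hasSum (hz : Continuous z) (ho : z o = 0) {p : ℕ → ℝ}
    (hp : ∀ k, 0 < p k) (hsum : HasSum p 1) {Q : ℝ} (hQ : HasSum (fun k => p k * chain.entropy k) Q)
    {l A : ℝ} (hA : HasSum (fun k => p k * mgf (chain.increment z k) (μ.prod μ) (l / p k)) A)
    (w : C) : Real.exp (l * z w - Q) ≤ A := by
  have hmgf (k : ℕ) : 0 < mgf (chain.increment z k) (μ.prod μ) (l / p k) :=
    mgf_pos (integrable_of_continuous ((chain.continuous_increment hz k).const_mul _).rexp)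
  have hApos : 0 < A := hA.tsum_eq ▸ hA.summable.tsum_pos
    (fun k => (mul_pos (hp k) (hmgf k)).le) 0 (mul_pos (hp 0) (hmgf 0))
  -- the tangent line of the logarithm at `A`
  have hcgf (k : ℕ) : cgf (chain.increment z k) (μ.prod μ) (l / p k)
      ≤ Real.log A - 1 + mgf (chain.increment z k) (μ.prod μ) (l / p k) * A⁻¹ := by
    have := Real.log_le_sub_one_of_pos (div_pos (hmgf k) hApos)
    rw [Real.log_div (hmgf k).ne' hApos.ne'] at this
    rw [cgf, ← div_eq_mul_inv]
    linarith
  have hlim : HasSum (fun k => p k * (chain.entropy k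
      + (Real.log A - 1 + mgf (chain.increment z k) (μ.prod μ) (l / p k) * A⁻¹)))
      (Q + Real.log A) := by
    convert hQ.add ((hsum.mul_right (Real.log A - 1)).add (hA.mul_right A⁻¹)) using 1
    · ext k; ring
    · rw [mul_inv_cancel₀ hApos.ne']; ring
  have hle : l * z w ≤ Q + Real.log A :=
    le_of_tendsto_of_tendsto' ((chain.tendsto_average hz w).const_mul l) hlim.tendsto_sum_nat
      fun n => (chain.mul_average_le hz ho hp l n w).trans
        (Finset.sum_le_sum fun k _ => by gcongr; exacts [(hp k).le, hcgf k])
  calc Real.exp (l * z w - Q) ≤ Real.exp (Real.log A) := Real.exp_le_exp.2 (by linarith)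
    _ = A := Real.exp_log hApos

theorem exp_mul_sub_le_envelope {Ω : Type*} {Z : C → Ω → ℝ} {ω : Ω} (hZ : Continuous (Z · ω))
    (ho : Z o ω = 0) {p : ℕ → ℝ} (hp : ∀ k, 0 < p k) (hsum : HasSum p 1) {Q : ℝ}
    (hQ : HasSum (fun k => p k * chain.entropy k) Q)
    (l : ℝ) (w : C) :
    ENNReal.ofReal (Real.exp (l * Z w ω - Q)) ≤ chain.envelope Z p l ω := by
  set M : ℕ → ℝ := fun k => p k * mgf (chain.increment (Z · ω) k) (μ.prod μ) (l / p k)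
  have hM (k : ℕ) : 0 ≤ M k := mul_nonneg (hp k).le mgf_nonneg
  have henv : chain.envelope Z p l ω = ∑' k, ENNReal.ofReal (M k) := by
    refine tsum_congr fun k => ?_
    rw [ENNReal.ofReal_mul (hp k).le, mgf, ofReal_integral_eq_lintegral_ofReal
      (integrable_of_continuous ((chain.continuous_increment hZ k).const_mul _).rexp)
      (ae_of_all _ fun _ => (Real.exp_pos _).le)]
  rw [henv]
  by_cases htop : ∑' k, ENNReal.ofReal (M k) = ⊤
  · exact htop ▸ le_top
  have hsummable : Summable M := by
    simpa only [ENNReal.toReal_ofReal (hM _)] using ENNReal.summable_toReal htop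
  rw [← ENNReal.ofReal_tsum_of_nonneg hM hsummable]
  exact ENNReal.ofReal_le_ofReal
    (chain.exp_mul_sub_le_of_hasSum hZ ho hp hsum hQ hsummable.hasSum w)

end AveragingChain

end Chaining

section Homothety

/-- The uniform distribution on a set `B`, as a measure on the subtype. -/
noncomputable def uniformMeasure {E : Type*} [MeasurableSpace E] (ν : Measure E) (B : Set E) :
    Measure B :=
  (ν B)⁻¹ • ν.comap (↑)

theorem isProbabilityMeasure_uniformMeasure {E : Type*} [MeasurableSpace E] {ν : Measure E}
    {B : Set E} (hB : MeasurableSet B) (h0 : ν B ≠ 0) (htop : ν B ≠ ⊤) :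
    IsProbabilityMeasure (uniformMeasure ν B) := by
  constructor
  rw [uniformMeasure, Measure.smul_apply, (MeasurableEmbedding.subtype_coe hB).comap_apply]
  simp [ENNReal.inv_mul_cancel h0 htop]

/-- The `p`-weights of the links of the homothety chain; they are proportional to the bounds
`R, 2R/3, 2R/9, …` on the lengths of the links in a set of radius `R`. -/
noncomputable def homothetyWeight : ℕ → ℝ
  | 0 => 1 / 2
  | k + 1 => (1 / 3) ^ (k + 1)

theorem homothetyWeight_pos : ∀ k, 0 < homothetyWeight k
  | 0 => by norm_num [homothetyWeight]
  | k + 1 => by simp only [homothetyWeight]; positivity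

theorem hasSum_homothetyWeight : HasSum homothetyWeight 1 := by
  have hgeom := (hasSum_geometric_of_lt_one (r := (1 / 3 : ℝ)) (by norm_num)
    (by norm_num)).mul_right (1 / 3)
  have hval : (1 - 1 / 3 : ℝ)⁻¹ * (1 / 3) = 1 - homothetyWeight 0 := by norm_num [homothetyWeight]
  rw [← hasSum_nat_add_iff' 1, Finset.sum_range_one, ← hval]
  exact hgeom.congr_fun fun k => pow_succ _ _

theorem hasSum_homothetyWeight_mul_succ :
    HasSum (fun k : ℕ => homothetyWeight k * (k + 1)) (7 / 4) := by
  have hgeom := ((hasSum_geometric_of_lt_one (r := (1 / 3 : ℝ)) (by norm_num)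
    (by norm_num)).mul_right (2 / 3)).add ((hasSum_coe_mul_geometric_of_norm_lt_one
      (r := (1 / 3 : ℝ)) (by norm_num)).mul_right (1 / 3))
  have hval : (1 - 1 / 3 : ℝ)⁻¹ * (2 / 3) + 1 / 3 / (1 - 1 / 3) ^ 2 * (1 / 3)
      = 7 / 4 - homothetyWeight 0 * ((0 : ℕ) + 1) := by norm_num [homothetyWeight]
  rw [← hasSum_nat_add_iff' 1, Finset.sum_range_one, ← hval]
  refine hgeom.congr_fun fun k => ?_
  simp only [homothetyWeight]
  push_cast
  ring

variable {E : Type*} [NormedAddCommGroup E] [NormedSpace ℝ E] {B : Set E}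

/-- The homothety of ratio `c` centred at `w`, evaluated at `u`, within a convex set. -/
def contract (hB : Convex ℝ B) (c : unitInterval) (w u : B) : B :=
  ⟨AffineMap.homothety (w : E) (c : ℝ) u, hB.lineMap_mem w.2 u.2 c.2⟩

theorem continuous_contract (hB : Convex ℝ B) (c : unitInterval) :
    Continuous fun q : B × B => contract hB c q.1 q.2 := by
  refine Continuous.subtype_mk ?_ _
  simp only [AffineMap.homothety_apply, vsub_eq_sub, vadd_eq_add]
  fun_prop

variable [FiniteDimensional ℝ E] [MeasurableSpace E] [BorelSpace E]

theorem map_contract_le (ν : Measure E) [ν.IsAddHaarMeasure] (hBm : MeasurableSet B)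
    (hB : Convex ℝ B) {c : unitInterval} (hc : c ≠ 0) (w : B) :
    (uniformMeasure ν B).map (contract hB c w)
      ≤ ENNReal.ofReal (((c : ℝ) ^ Module.finrank ℝ E)⁻¹) • uniformMeasure ν B := by
  have hm : Measurable (contract hB c w) :=
    ((continuous_contract hB c).comp (Continuous.prodMk_right w)).measurable
  have hcpos : 0 < (c : ℝ) ^ Module.finrank ℝ E := pow_pos (unitInterval.pos_iff_ne_zero.2 hc) _
  refine Measure.le_iff.2 fun s hs => ?_
  have himage : AffineMap.homothety (w : E) (c : ℝ) '' ((↑) '' (contract hB c w ⁻¹' s))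
      ⊆ ((↑) '' s : Set E) := by
    rintro _ ⟨_, ⟨u, hu, rfl⟩, rfl⟩
    exact ⟨contract hB c w u, hu, rfl⟩
  have hvol := measure_mono (μ := ν) himage
  rw [Measure.addHaar_image_homothety, abs_of_pos hcpos] at hvol
  rw [Measure.map_apply hm hs]
  simp only [uniformMeasure, Measure.smul_apply, smul_eq_mul,
    (MeasurableEmbedding.subtype_coe hBm).comap_apply]
  rw [mul_left_comm, ENNReal.ofReal_inv_of_pos hcpos]
  gcongr
  rwa [← ENNReal.mul_le_iff_le_inv (ENNReal.ofReal_pos.2 hcpos).ne' ENNReal.ofReal_ne_top]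

/-- The chain of averages over the homothetic copies of ratio `3⁻ᵏ` of a convex set. -/
noncomputable def homothetyChain (ν : Measure E) [ν.IsAddHaarMeasure] (hBm : MeasurableSet B)
    (hB : Convex ℝ B) (o : B) : AveragingChain (uniformMeasure ν B) o where
  link
    | 0, _, _ => o
    | k + 1, w, u => contract hB (⟨1 / 3, by norm_num⟩ ^ (k + 1)) w u
  entropy k := (k + 1) * (Module.finrank ℝ E * Real.log 3)
  link_zero _ _ := rfl
  continuous_link
    | 0 => continuous_const
    | k + 1 => continuous_contract hB _
  tendsto_link w u := by
    rw [← tendsto_add_atTop_iff_nat 1, tendsto_subtype_rng]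
    have hpow : Tendsto (fun k : ℕ => (1 / 3 : ℝ) ^ (k + 1)) atTop (𝓝 0) :=
      (tendsto_pow_atTop_nhds_zero_of_lt_one (by norm_num) (by norm_num)).comp
        (tendsto_add_atTop_nat 1)
    simpa [contract, AffineMap.homothety_apply] using
      (hpow.smul_const ((u : E) - w)).add_const (w : E)
  map_link_succ_le k w := by
    convert map_contract_le ν hBm hB (c := ⟨1 / 3, by norm_num⟩ ^ (k + 1))
      (pow_ne_zero _ (by simp [Subtype.ext_iff])) w using 3
    have hexp : ((k : ℝ) + 1) * (Module.finrank ℝ E * Real.log 3)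
        = ((k + 1) * Module.finrank ℝ E : ℕ) * Real.log 3 := by push_cast; ring
    rw [hexp, Real.exp_nat_mul, Real.exp_log (by norm_num), Set.Icc.coe_pow, ← pow_mul]
    simp

theorem norm_sub_homothetyChain_link_le {F : Type*} [NormedAddCommGroup F] [NormedSpace ℝ F]
    (A : E →L[ℝ] F) {ν : Measure E} [ν.IsAddHaarMeasure] {hBm : MeasurableSet B}
    {hB : Convex ℝ B} {o : B} {R : ℝ} (hR : ∀ a ∈ B, ‖A (a - o)‖ ≤ R) (k : ℕ) (w u : B) :
    ‖A ((w : E) - (homothetyChain ν hBm hB o).link k w u)‖ ≤ 2 * R * homothetyWeight k := by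
  cases k with
  | zero => exact (hR w w.2).trans_eq (by rw [homothetyWeight]; ring)
  | succ k =>
    have hdiff : (w : E) - (homothetyChain ν hBm hB o).link (k + 1) w u
        = (1 / 3 : ℝ) ^ (k + 1) • ((w - o) - (u - o) : E) := by
      simp only [homothetyChain, contract, AffineMap.homothety_apply, vsub_eq_sub, vadd_eq_add,
        Set.Icc.coe_pow]
      module
    rw [hdiff, map_smul, map_sub, norm_smul, Real.norm_of_nonneg (by positivity), mul_comm,
      homothetyWeight]
    gcongr
    linarith [norm_sub_le (A ((w : E) - o)) (A ((u : E) - o)), hR w w.2, hR u u.2]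

end Homothety

section Shells

variable {Ω E F : Type*} [NormedAddCommGroup E] [NormedSpace ℝ E] [NormedAddCommGroup F]
  [NormedSpace ℝ F] {B : Set E} {A : E →L[ℝ] F} {W : E → Ω → ℝ}

/-- The event that `W` exceeds `3 a² (1 + y²)` on the ellipsoid of radius `2 a y` around `o`. Up to
the factor `7 / 5` between consecutive radii, the level is the quadratic penalty there. -/
def shellEvent (B : Set E) (A : E →L[ℝ] F) (W : E → Ω → ℝ) (o : E) (a y : ℝ) : Set Ω :=
  {ω | ∃ x ∈ B, ‖A (x - o)‖ ≤ 2 * a * y ∧ 3 * a ^ 2 * (1 + y ^ 2) < W x ω}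

theorem mem_iUnion_shellEvent {o : E} {a : ℝ} (ha : 0 < a)
    (hA : Function.Injective A) (hWo : ∀ ω, W o ω = 0) {x : E} (hx : x ∈ B) {ω : Ω}
    (hlt : 3 * (a ^ 2 + ‖A (x - o)‖ ^ 2 / 2) < W x ω) :
    ω ∈ ⋃ n : ℕ, shellEvent B A W o a ((7 / 5) ^ n) ∪ shellEvent B A W o a ((7 / 5) ^ n)⁻¹ := by
  have hN : 0 < ‖A (x - o)‖ := by
    refine norm_pos_iff.2 fun h0 => hlt.not_ge ?_
    rw [sub_eq_zero.1 (hA (h0.trans (map_zero A).symm)), hWo]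
    positivity
  obtain ⟨j, hj, hj'⟩ := exists_mem_Ioc_zpow (x := ‖A (x - o)‖ / (2 * a)) (y := (7 / 5 : ℝ))
    (by positivity) (by norm_num)
  have hmem : ω ∈ shellEvent B A W o a ((7 / 5) ^ (j + 1)) := by
    refine ⟨x, hx, by rwa [div_le_iff₀ (by positivity), mul_comm] at hj', lt_of_le_of_lt ?_ hlt⟩
    rw [lt_div_iff₀ (by positivity)] at hj
    rw [zpow_add_one₀ (by norm_num)]
    have hsq := pow_le_pow_left₀ (by positivity) hj.le 2
    nlinarith [sq_nonneg ((7 / 5 : ℝ) ^ j * a)]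
  refine Set.mem_iUnion.2 ⟨(j + 1).natAbs, ?_⟩
  rcases Int.natAbs_eq (j + 1) with h | h
  · left
    rwa [h, zpow_natCast] at hmem
  · right
    rwa [h, zpow_neg, zpow_natCast] at hmem

theorem two_add_le_pow_add_inv_pow (n : ℕ) :
    2 + 4 / 35 * (n : ℝ) ≤ (7 / 5 : ℝ) ^ n + ((7 / 5 : ℝ) ^ n)⁻¹ := by
  induction n with
  | zero => norm_num
  | succ n ih =>
    have h1 : (1 : ℝ) ≤ (7 / 5 : ℝ) ^ n := one_le_pow₀ (by norm_num)
    have h2 : ((7 / 5 : ℝ) ^ n)⁻¹ ≤ 1 := inv_le_one_of_one_le₀ h1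
    rw [pow_succ, mul_inv]
    push_cast
    linarith

theorem exp_neg_mul_pow_add_inv_pow_le {l : ℝ} (hl : 35 / 9 ≤ l) (n : ℕ) :
    Real.exp (-(3 / 4 * l * ((7 / 5 : ℝ) ^ n + ((7 / 5 : ℝ) ^ n)⁻¹))) ≤
      Real.exp (-(3 / 2 * l)) * (3 / 4 : ℝ) ^ n := by
  have hexp : Real.exp (-(1 / 3 : ℝ)) ≤ 3 / 4 := by
    rw [Real.exp_neg, inv_le_comm₀ (Real.exp_pos _) (by norm_num)]
    linarith [Real.add_one_le_exp (1 / 3 : ℝ)]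
  calc Real.exp (-(3 / 4 * l * ((7 / 5 : ℝ) ^ n + ((7 / 5 : ℝ) ^ n)⁻¹)))
      ≤ Real.exp (-(3 / 2 * l) + n * (-(1 / 3 : ℝ))) := by
        refine Real.exp_le_exp.2 ?_
        have hpow := mul_le_mul_of_nonneg_left (two_add_le_pow_add_inv_pow n)
          (show 0 ≤ 3 / 4 * l by linarith)
        have hln := mul_le_mul_of_nonneg_right hl n.cast_nonneg
        linarith
    _ = Real.exp (-(3 / 2 * l)) * Real.exp (-(1 / 3 : ℝ)) ^ n := by
        rw [Real.exp_add, Real.exp_nat_mul]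
    _ ≤ Real.exp (-(3 / 2 * l)) * (3 / 4 : ℝ) ^ n := by gcongr

end Shells

section SubgaussianField

variable {Ω : Type*} [MeasurableSpace Ω] {P : Measure Ω}

theorem measure_le_of_eventually_mem {ι : Type*} {f : Filter ι} [f.NeBot] [f.IsCountablyGenerated]
    {s : Set Ω} {S : ι → Set Ω} {c : ENNReal} (hs : ∀ ω ∈ s, ∀ᶠ i in f, ω ∈ S i)
    (hS : ∀ᶠ i in f, P (S i) ≤ c) : P s ≤ c := by
  obtain ⟨u, hu⟩ := exists_seq_tendsto f
  have hmono : Monotone fun n => ⋂ m ≥ n, S (u m) := fun _ _ hmn =>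
    Set.biInter_subset_biInter_left fun _ => hmn.trans
  have hsub : s ⊆ ⋃ n, ⋂ m ≥ n, S (u m) := fun ω hω => by
    simpa only [Set.mem_iUnion, Set.mem_iInter] using eventually_atTop.1 (hu.eventually (hs ω hω))
  obtain ⟨n₀, hn₀⟩ := eventually_atTop.1 (hu.eventually hS)
  refine (measure_mono hsub).trans ?_
  rw [hmono.measure_iUnion]
  exact iSup_le fun n => (measure_mono (Set.biInter_subset_of_mem (le_max_left n n₀))).trans
    (hn₀ _ (le_max_right n n₀))

variable {E F : Type*} [NormedAddCommGroup E] [NormedSpace ℝ E] [NormedAddCommGroup F]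
  [NormedSpace ℝ F]

/-- A random field on `B` with continuous trajectories whose increments are sub-Gaussian with
respect to the seminorm `‖A ·‖`, up to the exponent `g` after normalization. -/
structure SubgaussianField (P : Measure Ω) (B : Set E) (A : E →L[ℝ] F) (g : ℝ)
    (W : E → Ω → ℝ) : Prop where
  continuousOn : ∀ ω, ContinuousOn (W · ω) B
  measurable : ∀ a ∈ B, Measurable (W a)
  lintegral_exp_le : ∀ a ∈ B, ∀ b ∈ B, ∀ t : ℝ, 0 < t → t * ‖A (a - b)‖ ≤ g →
    ∫⁻ ω, ENNReal.ofReal (Real.exp (t * (W a ω - W b ω))) ∂P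
      ≤ ENNReal.ofReal (Real.exp ((t * ‖A (a - b)‖) ^ 2 / 2))

namespace SubgaussianField

variable {B : Set E} {A : E →L[ℝ] F} {g : ℝ} {W : E → Ω → ℝ}

theorem mono (hW : SubgaussianField P B A g W) {B' : Set E} (hB : B' ⊆ B) :
    SubgaussianField P B' A g W where
  continuousOn ω := (hW.continuousOn ω).mono hB
  measurable a ha := hW.measurable a (hB ha)
  lintegral_exp_le a ha b hb := hW.lintegral_exp_le a (hB ha) b (hB hb)

theorem neg (hW : SubgaussianField P B A g W) :
    SubgaussianField P B A g fun a ω => -W a ω where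
  continuousOn ω := (hW.continuousOn ω).neg
  measurable a ha := (hW.measurable a ha).neg
  lintegral_exp_le a ha b hb := by
    rw [← neg_sub b a, map_neg, norm_neg]
    simpa only [neg_sub_neg] using hW.lintegral_exp_le b hb a ha

variable [FiniteDimensional ℝ E]

theorem exists_envelope [SFinite P] (hW : SubgaussianField P B A g W) (hBc : IsCompact B)
    (hB : Convex ℝ B) {o : E} (ho : o ∈ interior B) (hWo : ∀ ω, W o ω = 0) {R h : ℝ} (hR : 0 < R)
    (hBR : ∀ a ∈ B, ‖A (a - o)‖ ≤ R) (hh : 0 < h) (hhg : h ≤ g) :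
    ∃ J : Ω → ENNReal, Measurable J ∧ ∫⁻ ω, J ω ∂P ≤ ENNReal.ofReal (Real.exp (h ^ 2 / 2)) ∧
      ∀ ω, ∀ a ∈ B, ENNReal.ofReal (Real.exp
        (h / (2 * R) * W a ω - 7 / 4 * (Module.finrank ℝ E * Real.log 3))) ≤ J ω := by
  borelize E
  have : CompactSpace B := isCompact_iff_compactSpace.1 hBc
  have := isProbabilityMeasure_uniformMeasure (ν := Measure.addHaar) hBc.measurableSet
    (Measure.measure_pos_of_nonempty_interior Measure.addHaar ⟨o, ho⟩).ne' hBc.measure_lt_top.ne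
  set chain := homothetyChain Measure.addHaar hBc.measurableSet hB ⟨o, interior_subset ho⟩
  have hcont (ω : Ω) : Continuous fun a : B => W a ω := (hW.continuousOn ω).domRestrict
  have hentropy : HasSum (fun k => homothetyWeight k * chain.entropy k)
      (7 / 4 * (Module.finrank ℝ E * Real.log 3)) :=
    (hasSum_homothetyWeight_mul_succ.mul_right _).congr_fun fun k => (mul_assoc _ _ _).symm
  refine ⟨chain.envelope (fun a => W a) homothetyWeight (h / (2 * R)),
    chain.measurable_envelope hcont (fun a => hW.measurable a a.2) _ _,
    chain.lintegral_envelope_le hcont (fun a => hW.measurable a a.2)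
      (fun k => (homothetyWeight_pos k).le) hasSum_homothetyWeight fun k b u => ?_,
    fun ω a ha => chain.exp_mul_sub_le_envelope (hcont ω) (hWo ω) homothetyWeight_pos
      hasSum_homothetyWeight hentropy _ ⟨a, ha⟩⟩
  have hp := homothetyWeight_pos k
  have hlink : h / (2 * R) / homothetyWeight k * ‖A ((b : E) - chain.link k b u)‖ ≤ h := by
    rw [div_div, div_mul_eq_mul_div, div_le_iff₀ (by positivity)]
    gcongr
    exact norm_sub_homothetyChain_link_le A hBR k b u
  refine (hW.lintegral_exp_le b b.2 _ (chain.link k b u).2 _ (by positivity)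
    (hlink.trans hhg)).trans ?_
  gcongr

theorem measure_exists_lt_le_of_isCompact [SFinite P] (hW : SubgaussianField P B A g W)
    (hBc : IsCompact B) (hB : Convex ℝ B) {o : E} (ho : o ∈ interior B) (hWo : ∀ ω, W o ω = 0)
    {R h : ℝ} (hR : 0 < R) (hBR : ∀ a ∈ B, ‖A (a - o)‖ ≤ R) (hh : 0 < h) (hhg : h ≤ g) (M : ℝ) :
    P {ω | ∃ a ∈ B, M < W a ω} ≤ ENNReal.ofReal (Real.exp
      (-(h / (2 * R) * M) + h ^ 2 / 2 + 7 / 4 * (Module.finrank ℝ E * Real.log 3))) := by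
  obtain ⟨J, hJm, hJint, hJ⟩ := hW.exists_envelope hBc hB ho hWo hR hBR hh hhg
  set c : ℝ := h / (2 * R) * M - 7 / 4 * (Module.finrank ℝ E * Real.log 3)
  have hsub : {ω | ∃ a ∈ B, M < W a ω} ⊆ {ω | ENNReal.ofReal (Real.exp c) ≤ J ω} := by
    rintro ω ⟨a, ha, hM⟩
    refine le_trans (ENNReal.ofReal_le_ofReal (Real.exp_le_exp.2 ?_)) (hJ ω a ha)
    exact sub_le_sub_right (by gcongr) _
  calc P {ω | ∃ a ∈ B, M < W a ω} ≤ P {ω | ENNReal.ofReal (Real.exp c) ≤ J ω} := measure_mono hsub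
    _ ≤ (∫⁻ ω, J ω ∂P) / ENNReal.ofReal (Real.exp c) := meas_ge_le_lintegral_div hJm.aemeasurable
        (ENNReal.ofReal_pos.2 (Real.exp_pos _)).ne' ENNReal.ofReal_ne_top
    _ ≤ ENNReal.ofReal (Real.exp (h ^ 2 / 2)) / ENNReal.ofReal (Real.exp c) := by gcongr
    _ = _ := by
        rw [← ENNReal.ofReal_div_of_pos (Real.exp_pos _), ← Real.exp_sub]
        congr 2
        ring

theorem measure_exists_lt_le [SFinite P] (hW : SubgaussianField P B A g W)
    (hBb : Bornology.IsBounded B) (hB : Convex ℝ B) {o : E} (ho : o ∈ interior B)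
    (hWo : ∀ ω, W o ω = 0) {R h : ℝ} (hR : 0 < R) (hBR : ∀ a ∈ B, ‖A (a - o)‖ ≤ R) (hh : 0 < h)
    (hhg : h ≤ g) (M : ℝ) :
    P {ω | ∃ a ∈ B, M < W a ω} ≤ ENNReal.ofReal (Real.exp
      (-(h / (2 * R) * M) + h ^ 2 / 2 + 7 / 4 * (Module.finrank ℝ E * Real.log 3))) := by
  -- exhaust `B` by the compact convex sets `homothety o c '' closure B`, `c ↑ 1`
  set K : ℝ → Set E := fun c => AffineMap.homothety o c '' closure B
  have hKB {c : ℝ} (hc : c ∈ Set.Ioo (0 : ℝ) 1) : K c ⊆ B := by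
    rintro _ ⟨x, hx, rfl⟩
    convert interior_subset (hB.combo_interior_closure_mem_interior ho hx (sub_pos.2 hc.2) hc.1.le
      (sub_add_cancel 1 c)) using 1
    simp only [AffineMap.homothety_apply, vsub_eq_sub, vadd_eq_add]
    module
  have hKo {c : ℝ} (hc : c ≠ 0) : o ∈ interior (K c) :=
    interior_maximal (Set.image_mono (interior_subset.trans subset_closure))
      (AffineMap.homothety_isOpenMap o c hc _ isOpen_interior)
      ⟨o, ho, AffineMap.homothety_apply_same o c⟩
  have hIoo : ∀ᶠ c in 𝓝[<] (1 : ℝ), c ∈ Set.Ioo (0 : ℝ) 1 := Ioo_mem_nhdsLT zero_lt_one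
  refine measure_le_of_eventually_mem (f := 𝓝[<] (1 : ℝ)) (S := fun c => {ω | ∃ a ∈ K c, M < W a ω})
    (fun ω ⟨a, ha, hM⟩ => ?_) (hIoo.mono fun c hc => ?_)
  · have hlim : Tendsto (fun c : ℝ => AffineMap.homothety o c a) (𝓝[<] 1) (𝓝[B] a) := by
      refine tendsto_nhdsWithin_iff.2 ⟨?_, hIoo.mono fun c hc => hKB hc ⟨a, subset_closure ha, rfl⟩⟩
      have hcont : Continuous fun c : ℝ => AffineMap.homothety o c a := AffineMap.lineMap_continuous
      simpa using (hcont.tendsto 1).mono_left nhdsWithin_le_nhds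
    filter_upwards [((hW.continuousOn ω a ha).tendsto.comp hlim).eventually (lt_mem_nhds hM)]
      with c hc
    exact ⟨_, ⟨a, subset_closure ha, rfl⟩, hc⟩
  · exact (hW.mono (hKB hc)).measure_exists_lt_le_of_isCompact
      (hBb.isCompact_closure.image (AffineMap.homothety_continuous o c))
      (hB.closure.affine_image _) (hKo hc.1.ne') hWo hR (fun a ha => hBR a (hKB hc ha)) hh hhg M

theorem ae_exists_forall_le [SFinite P] (hW : SubgaussianField P B A g W)
    (hBb : Bornology.IsBounded B) (hB : Convex ℝ B) {o : E} (ho : o ∈ interior B)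
    (hWo : ∀ ω, W o ω = 0) (hg : 0 < g) : ∀ᵐ ω ∂P, ∃ M : ℝ, ∀ a ∈ B, W a ω ≤ M := by
  obtain ⟨C, hC⟩ := hBb.exists_norm_le
  set R : ℝ := ‖A‖ * (C + ‖o‖) + 1
  have hR : 0 < R := by
    have := (norm_nonneg o).trans (hC o (interior_subset ho))
    positivity
  have hBR (a) (ha : a ∈ B) : ‖A (a - o)‖ ≤ R := by
    calc ‖A (a - o)‖ ≤ ‖A‖ * ‖a - o‖ := A.le_opNorm _
      _ ≤ ‖A‖ * (C + ‖o‖) := by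
        gcongr
        exact (norm_sub_le a o).trans (by gcongr; exact hC a ha)
      _ ≤ R := (lt_add_one _).le
  have hlim : Tendsto (fun M : ℝ => ENNReal.ofReal (Real.exp (-(g / (2 * R) * M) + g ^ 2 / 2 +
      7 / 4 * (Module.finrank ℝ E * Real.log 3)))) atTop (𝓝 0) := by
    rw [← ENNReal.ofReal_zero]
    refine (ENNReal.continuous_ofReal.tendsto 0).comp (Real.tendsto_exp_atBot.comp ?_)
    refine tendsto_atBot_add_const_right _ _ (tendsto_atBot_add_const_right _ _ ?_)
    exact tendsto_neg_atTop_atBot.comp (tendsto_id.const_mul_atTop (by positivity))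
  refine ae_iff.2 (le_antisymm (ge_of_tendsto' hlim fun M => le_trans (measure_mono fun ω hω => ?_)
    (hW.measure_exists_lt_le hBb hB ho hWo hR hBR hg le_rfl M)) zero_le)
  simpa only [not_exists, not_forall, not_le, exists_prop, Set.mem_ofPred_eq] using
    not_exists.1 hω M

theorem measure_exists_norm_le_lt_le [SFinite P] (hW : SubgaussianField P B A g W)
    (hBb : Bornology.IsBounded B) (hB : Convex ℝ B) {o : E} (ho : o ∈ interior B)
    (hWo : ∀ ω, W o ω = 0) {R h : ℝ} (hR : 0 < R) (hh : 0 < h) (hhg : h ≤ g) (M : ℝ) :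
    P {ω | ∃ a ∈ B, ‖A (a - o)‖ ≤ R ∧ M < W a ω} ≤ ENNReal.ofReal (Real.exp
      (-(h / (2 * R) * M) + h ^ 2 / 2 + 7 / 4 * (Module.finrank ℝ E * Real.log 3))) := by
  set K : Set E := {a ∈ B | ‖A (a - o)‖ ≤ R} with hK
  have hKB : K ⊆ B := Set.sep_subset _ _
  have hKpre : K = B ∩ A ⁻¹' Metric.closedBall (A o) R := by
    ext a
    simp only [hK, Set.mem_ofPred_eq, map_sub, Set.mem_inter_iff, Set.mem_preimage,
      mem_closedBall_iff_norm]
  have hKconv : Convex ℝ K :=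
    hKpre ▸ hB.inter ((convex_closedBall _ _).linear_preimage A.toLinearMap)
  have hKo : o ∈ interior K := by
    rw [mem_interior_iff_mem_nhds, hKpre]
    exact inter_mem (mem_interior_iff_mem_nhds.1 ho)
      (A.continuous.continuousAt.preimage_mem_nhds (Metric.closedBall_mem_nhds _ hR))
  convert (hW.mono hKB).measure_exists_lt_le (hBb.subset hKB) hKconv hKo hWo hR
    (fun a ha => ha.2) hh hhg M using 5
  simp only [hK, Set.mem_ofPred_eq, and_assoc]

theorem measure_shellEvent_le [SFinite P] (hW : SubgaussianField P B A g W)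
    (hBb : Bornology.IsBounded B) (hB : Convex ℝ B) {o : E} (ho : o ∈ interior B)
    (hWo : ∀ ω, W o ω = 0) {a l y : ℝ} (ha : 0 < a) (hy : 0 < y) (hl : 0 < l) (hlg : l ≤ g) :
    P (shellEvent B A W o a y) ≤ ENNReal.ofReal (Real.exp (-(3 / 4 * (l * a) * (y + y⁻¹)) +
      l ^ 2 / 2 + 7 / 4 * (Module.finrank ℝ E * Real.log 3))) := by
  refine (hW.measure_exists_norm_le_lt_le hBb hB ho hWo (by positivity) hl hlg _).trans_eq ?_
  congr 4
  field_simp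
  ring

theorem measure_shellEvent_union_le [SFinite P] (hW : SubgaussianField P B A g W)
    (hBb : Bornology.IsBounded B) (hB : Convex ℝ B) {o : E} (ho : o ∈ interior B)
    (hWo : ∀ ω, W o ω = 0) {a l : ℝ} (ha : 0 < a) (hl : 0 < l) (hlg : l ≤ g)
    (hla : 35 / 9 ≤ l * a) (n : ℕ) :
    P (shellEvent B A W o a ((7 / 5) ^ n) ∪ shellEvent B A W o a ((7 / 5) ^ n)⁻¹) ≤
      ENNReal.ofReal (2 * Real.exp (7 / 4 * (Module.finrank ℝ E * Real.log 3) + l ^ 2 / 2 -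
        3 / 2 * (l * a)) * (3 / 4) ^ n) := by
  set q := 7 / 4 * (Module.finrank ℝ E * Real.log 3)
  set y : ℝ := (7 / 5) ^ n
  have hshell {z : ℝ} (hz : 0 < z) (hzy : z + z⁻¹ = y + y⁻¹) : P (shellEvent B A W o a z) ≤
      ENNReal.ofReal (Real.exp (q + l ^ 2 / 2 - 3 / 2 * (l * a)) * (3 / 4) ^ n) := by
    refine (hW.measure_shellEvent_le hBb hB ho hWo ha hz hl hlg).trans
      (ENNReal.ofReal_le_ofReal ?_)
    calc Real.exp (-(3 / 4 * (l * a) * (z + z⁻¹)) + l ^ 2 / 2 + q)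
        = Real.exp (q + l ^ 2 / 2) * Real.exp (-(3 / 4 * (l * a) * (y + y⁻¹))) := by
          rw [hzy, ← Real.exp_add]
          ring_nf
      _ ≤ Real.exp (q + l ^ 2 / 2) * (Real.exp (-(3 / 2 * (l * a))) * (3 / 4) ^ n) := by
          gcongr
          exact exp_neg_mul_pow_add_inv_pow_le hla n
      _ = Real.exp (q + l ^ 2 / 2 - 3 / 2 * (l * a)) * (3 / 4) ^ n := by
          rw [← mul_assoc, ← Real.exp_add, sub_eq_add_neg]
  rw [mul_assoc, two_mul, ENNReal.ofReal_add (by positivity) (by positivity)]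
  exact (measure_union_le _ _).trans (add_le_add (hshell (by positivity) rfl)
    (hshell (by positivity) (by rw [inv_inv, add_comm])))

theorem measure_exists_quadratic_lt_le [SFinite P] (hW : SubgaussianField P B A g W)
    (hBb : Bornology.IsBounded B) (hB : Convex ℝ B) {o : E} (ho : o ∈ interior B)
    (hWo : ∀ ω, W o ω = 0) (hA : Function.Injective A) {a l : ℝ} (ha : 0 < a) (hl : 0 < l)
    (hlg : l ≤ g) (hla : 35 / 9 ≤ l * a) :
    P {ω | ∃ x ∈ B, 3 * (a ^ 2 + ‖A (x - o)‖ ^ 2 / 2) < W x ω} ≤ ENNReal.ofReal (8 * Real.exp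
      (7 / 4 * (Module.finrank ℝ E * Real.log 3) + l ^ 2 / 2 - 3 / 2 * (l * a))) := by
  set c := 2 * Real.exp (7 / 4 * (Module.finrank ℝ E * Real.log 3) + l ^ 2 / 2 - 3 / 2 * (l * a))
    with hc
  have hsum : HasSum (fun n : ℕ => c * (3 / 4) ^ n) (c * (1 - 3 / 4)⁻¹) :=
    (hasSum_geometric_of_lt_one (by norm_num) (by norm_num)).mul_left c
  calc P {ω | ∃ x ∈ B, 3 * (a ^ 2 + ‖A (x - o)‖ ^ 2 / 2) < W x ω}
      ≤ P (⋃ n : ℕ, shellEvent B A W o a ((7 / 5) ^ n) ∪ shellEvent B A W o a ((7 / 5) ^ n)⁻¹) :=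
        measure_mono fun ω ⟨x, hx, hlt⟩ => mem_iUnion_shellEvent ha hA hWo hx hlt
    _ ≤ ∑' n : ℕ, ENNReal.ofReal (c * (3 / 4) ^ n) := (measure_iUnion_le _).trans
        (ENNReal.tsum_le_tsum (hW.measure_shellEvent_union_le hBb hB ho hWo ha hl hlg hla))
    _ = ENNReal.ofReal (c * (1 - 3 / 4)⁻¹) := by
        rw [← ENNReal.ofReal_tsum_of_nonneg (fun n => by positivity) hsum.summable, hsum.tsum_eq]
    _ = _ := by
        rw [hc]
        ring_nf

end SubgaussianField

end SubgaussianField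

section Quantile

theorem log_three_le : Real.log 3 ≤ 8 / 7 := by
  rw [Real.log_le_iff_le_exp (by norm_num)]
  have hexp : Real.exp (8 / 7) = Real.exp 1 * Real.exp (1 / 7) := by
    rw [← Real.exp_add]
    norm_num
  nlinarith [Real.exp_one_gt_d9, Real.add_one_le_exp (1 / 7 : ℝ)]

theorem eight_mul_exp_le (y : ℝ) : 8 * Real.exp y ≤ Real.exp (y + 21 / 10) := by
  have hlog : Real.log 8 = 3 * Real.log 2 := by
    rw [show (8 : ℝ) = 2 ^ 3 by norm_num, Real.log_pow]
    norm_num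
  have hexp : (8 : ℝ) ≤ Real.exp (21 / 10) := by
    rw [← Real.log_le_iff_le_exp (by norm_num), hlog]
    linarith [Real.log_two_lt_d9]
  rw [Real.exp_add, mul_comm (Real.exp y)]
  gcongr

theorem two_mul_le_entropyConst (p : ℕ) : 2 * (p : ℝ) ≤ entropyConst p := by
  unfold entropyConst
  split_ifs <;> nlinarith [p.cast_nonneg (α := ℝ)]

theorem exists_level_lt_zQ {p : ℕ} (hp : 0 < p) {G x : ℝ} (hG : 3 ≤ G) (hx : 0 ≤ x) :
    ∃ a l : ℝ, 0 < a ∧ 0 < l ∧ l ≤ G ∧ 35 / 9 ≤ l * a ∧ a ^ 2 < zQ G x (entropyConst p) ∧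
      8 * Real.exp (7 / 4 * (p * Real.log 3) + l ^ 2 / 2 - 3 / 2 * (l * a)) ≤ Real.exp (-x) := by
  have hp1 : (1 : ℝ) ≤ p := Nat.one_le_cast.2 hp
  have hQ := two_mul_le_entropyConst p
  set Q := entropyConst p
  set s := Real.sqrt (x + Q)
  have hs : s ^ 2 = x + Q := Real.sq_sqrt (by linarith)
  have hs0 : 0 ≤ s := Real.sqrt_nonneg _
  have hs1 : (7 / 5 : ℝ) ≤ s := by nlinarith
  have hent : 7 / 4 * (p * Real.log 3) ≤ 2 * p := by nlinarith [log_three_le]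
  unfold zQ
  split_ifs with hsG
  · -- the optimal exponent `l = a` is admissible
    refine ⟨s + 3 / 4, s + 3 / 4, by linarith, by linarith, by linarith, by nlinarith,
      by nlinarith, (eight_mul_exp_le _).trans (Real.exp_le_exp.2 ?_)⟩
    nlinarith
  · have hG0 : 0 < G := by linarith
    have hxQ : 0 ≤ x + Q := by linarith
    have hmul : G * (2 * G⁻¹ * (x + Q) + G) = 2 * (x + Q) + G ^ 2 := by field_simp
    refine ⟨2 * G⁻¹ * (x + Q) + G, G, by positivity, hG0, le_rfl, ?_, by linarith,
      (eight_mul_exp_le _).trans (Real.exp_le_exp.2 ?_)⟩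
    · rw [hmul]
      nlinarith
    · rw [hmul]
      nlinarith

end Quantile

section PenalizedSup

variable {E F : Type*} [NormedAddCommGroup E] [NormedSpace ℝ E] [NormedAddCommGroup F]
  [NormedSpace ℝ F] {B : Set E} {A : E →L[ℝ] F} {o : E} {w : ℝ}

/-- The supremum over `B` of `f` minus the quadratic penalty `(w / 2) ‖A (· - o)‖²`, an extended
real number as for the errors `♦_ε`, which are suprema of this form. -/
noncomputable def penalizedSup (B : Set E) (A : E →L[ℝ] F) (o : E) (w : ℝ) (f : E → ℝ) : EReal :=
  ⨆ x ∈ B, ((f x - w / 2 * ‖A (x - o)‖ ^ 2 : ℝ) : EReal)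

theorem penalizedSup_lt_top (hw : 0 ≤ w) {f : E → ℝ} {M : ℝ} (hM : ∀ x ∈ B, f x ≤ M) :
    penalizedSup B A o w f < ⊤ :=
  (iSup₂_le fun x hx => EReal.coe_le_coe_iff.2
    ((sub_le_self _ (by positivity)).trans (hM x hx))).trans_lt (EReal.coe_lt_top M)

theorem inv_mul_penalizedSup_le (hw : 0 < w) {f : E → ℝ} {z : ℝ}
    (hf : ∀ x ∈ B, f x ≤ w * (z + ‖A (x - o)‖ ^ 2 / 2)) :
    ((w⁻¹ : ℝ) : EReal) * penalizedSup B A o w f ≤ z := by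
  have hsup : penalizedSup B A o w f ≤ ((w * z : ℝ) : EReal) :=
    iSup₂_le fun x hx => EReal.coe_le_coe_iff.2 (by linarith [hf x hx])
  refine (mul_le_mul_of_nonneg_left hsup (EReal.coe_nonneg.2 (inv_pos.2 hw).le)).trans_eq ?_
  rw [← EReal.coe_mul, inv_mul_cancel_left₀ hw.ne']

variable [FiniteDimensional ℝ E] {Ω : Type*} [MeasurableSpace Ω] {P : Measure Ω} [SFinite P]
  {Z : E → Ω → ℝ} {c g : ℝ}

theorem SubgaussianField.ae_penalizedSup_lt_top
    (hZ : SubgaussianField P B A g fun x ω => c⁻¹ * Z x ω) (hc : 0 < c)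
    (hBb : Bornology.IsBounded B) (hB : Convex ℝ B) (ho : o ∈ interior B) (hZo : ∀ ω, Z o ω = 0)
    (hg : 0 < g) (hw : 0 ≤ w) : ∀ᵐ ω ∂P, penalizedSup B A o w (Z · ω) < ⊤ := by
  filter_upwards [hZ.ae_exists_forall_le hBb hB ho (fun ω => by rw [hZo, mul_zero]) hg]
    with ω ⟨M, hM⟩
  exact penalizedSup_lt_top hw fun x hx => (inv_mul_le_iff₀ hc).1 (hM x hx)

theorem SubgaussianField.measure_zQ_le_penalizedSup_le
    (hZ : SubgaussianField P B A g fun x ω => c⁻¹ * Z x ω) (hc : 0 < c)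
    (hBb : Bornology.IsBounded B) (hB : Convex ℝ B) (ho : o ∈ interior B) (hZo : ∀ ω, Z o ω = 0)
    (hA : Function.Injective A) (hE : 0 < Module.finrank ℝ E) (hg : 3 ≤ g) (hw : 3 * c ≤ w)
    {x : ℝ} (hx : 0 ≤ x) :
    P {ω | (zQ g x (entropyConst (Module.finrank ℝ E)) : EReal) ≤
      ((w⁻¹ : ℝ) : EReal) * penalizedSup B A o w (Z · ω)} ≤ ENNReal.ofReal (Real.exp (-x)) := by
  obtain ⟨a, l, ha, hl, hlg, hla, haz, hexp⟩ := exists_level_lt_zQ hE hg hx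
  refine (measure_mono fun ω hω => ?_).trans ((hZ.measure_exists_quadratic_lt_le hBb hB ho
    (fun ω => by rw [hZo, mul_zero]) hA ha hl hlg hla).trans (ENNReal.ofReal_le_ofReal hexp))
  by_contra! hsmall
  simp only [Set.mem_ofPred_eq, not_exists, not_and, not_lt] at hsmall
  refine (EReal.coe_lt_coe_iff.2 haz).not_ge (hω.trans (inv_mul_penalizedSup_le (by linarith) ?_))
  intro y hy
  calc Z y ω ≤ c * (3 * (a ^ 2 + ‖A (y - o)‖ ^ 2 / 2)) := (inv_mul_le_iff₀ hc).1 (hsmall y hy)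
    _ = 3 * c * (a ^ 2 + ‖A (y - o)‖ ^ 2 / 2) := by ring
    _ ≤ w * (a ^ 2 + ‖A (y - o)‖ ^ 2 / 2) := by gcongr

end PenalizedSup

section Gradient

variable {Ω : Type*} [MeasurableSpace Ω] {P : Measure Ω}

theorem measurable_of_hasDerivWithinAt_Ioi {f : ℝ → Ω → ℝ} {f' : Ω → ℝ} {a b : ℝ} (hab : a < b)
    (hf : ∀ t ∈ Set.Ico a b, Measurable (f t))
    (hder : ∀ ω, HasDerivWithinAt (f · ω) (f' ω) (Set.Ioi a) a) : Measurable f' := by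
  obtain ⟨u, -, hu, hua⟩ := exists_seq_strictAnti_tendsto' hab
  have huIoi : Tendsto u atTop (𝓝[>] a) :=
    tendsto_nhdsWithin_iff.2 ⟨hua, Eventually.of_forall fun n => (hu n).1⟩
  refine measurable_of_tendsto_metrizable (f := fun n ω => slope (f · ω) a (u n))
    (fun n => ?_) (tendsto_pi_nhds.2 fun ω => ?_)
  · simp only [slope_def_field]
    exact ((hf _ (Set.Ioo_subset_Ico_self (hu n))).sub
      (hf a (Set.left_mem_Ico.2 hab))).div_const _
  · exact ((hasDerivWithinAt_iff_tendsto_slope' Set.self_notMem_Ioi).1 (hder ω)).comp huIoi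

theorem aemeasurable_uncurry_of_hasDerivAt [SFinite P] {f f' : ℝ → Ω → ℝ} {a b : ℝ} (hab : a ≤ b)
    (hf : ∀ t ∈ Set.Icc a b, Measurable (f t))
    (hder : ∀ ω, ∀ t ∈ Set.Icc a b, HasDerivAt (f · ω) (f' t ω) t) :
    AEMeasurable (Function.uncurry f') ((volume.restrict (Set.Ioo a b)).prod P) := by
  set F : ℝ → Ω → ℝ := fun t ω => Set.IccExtend hab (fun s => f s ω) t
  have hfc (ω : Ω) : ContinuousOn (f · ω) (Set.Icc a b) := fun t ht =>
    (hder ω t ht).continuousAt.continuousWithinAt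
  have hFm : Measurable (Function.uncurry F) :=
    measurable_uncurry_of_continuous_of_measurable (fun ω => (hfc ω).domRestrict.Icc_extend')
      fun t => hf _ (Subtype.prop _)
  have hFf (ω : Ω) {t : ℝ} (ht : t ∈ Set.Ioo a b) : (F · ω) =ᶠ[𝓝 t] (f · ω) := by
    filter_upwards [isOpen_Ioo.mem_nhds ht] with s hs
    exact Set.IccExtend_of_mem hab _ (Set.Ioo_subset_Icc_self hs)
  refine aemeasurable_of_tendsto_metrizable_ae (𝓝[≠] (0 : ℝ))
    (f := fun h q => h⁻¹ • (F (q.1 + h) q.2 - F q.1 q.2)) (fun h => ?_) ?_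
  · exact (((hFm.comp ((measurable_fst.add_const h).prodMk measurable_snd)).sub hFm).const_smul
      h⁻¹).aemeasurable
  · filter_upwards [Measure.quasiMeasurePreserving_fst.ae (ae_restrict_mem measurableSet_Ioo)]
      with q hq
    exact ((hder q.2 q.1 (Set.Ioo_subset_Icc_self hq)).congr_of_eventuallyEq
      (hFf q.2 hq)).tendsto_slope_zero

theorem integrable_exp_of_lintegral_le {X : Ω → ℝ} (hX : AEMeasurable X P) {M : ENNReal}
    (hM : M ≠ ⊤) (hXM : ∫⁻ ω, ENNReal.ofReal (Real.exp (X ω)) ∂P ≤ M) :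
    Integrable (fun ω => Real.exp (X ω)) P :=
  ⟨hX.exp.aestronglyMeasurable, (hasFiniteIntegral_iff_ofReal
    (ae_of_all _ fun _ => (Real.exp_pos _).le)).2 (hXM.trans_lt hM.lt_top)⟩

theorem lintegral_prod_le_of_ae_le {α : Type*} [MeasurableSpace α] {μ : Measure α}
    [IsProbabilityMeasure μ] [SFinite P] {φ : α × Ω → ENNReal} (hφ : AEMeasurable φ (μ.prod P))
    {M : ENNReal} (hM : ∀ᵐ a ∂μ, ∫⁻ ω, φ (a, ω) ∂P ≤ M) : ∫⁻ q, φ q ∂(μ.prod P) ≤ M := by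
  rw [lintegral_prod _ hφ]
  exact (lintegral_mono_ae hM).trans_eq (by rw [lintegral_const, measure_univ, mul_one])

theorem lintegral_exp_sub_le_of_hasDerivAt [SFinite P] {f f' : ℝ → Ω → ℝ}
    (hf : ∀ t ∈ Set.Icc (0 : ℝ) 1, Measurable (f t))
    (hder : ∀ ω, ∀ t ∈ Set.Icc (0 : ℝ) 1, HasDerivAt (f · ω) (f' t ω) t) {M : ENNReal} (hM : M ≠ ⊤)
    (hpos : ∀ t ∈ Set.Icc (0 : ℝ) 1, ∫⁻ ω, ENNReal.ofReal (Real.exp (f' t ω)) ∂P ≤ M)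
    (hneg : ∀ t ∈ Set.Icc (0 : ℝ) 1, ∫⁻ ω, ENNReal.ofReal (Real.exp (-f' t ω)) ∂P ≤ M) :
    ∫⁻ ω, ENNReal.ofReal (Real.exp (f 1 ω - f 0 ω)) ∂P ≤ M := by
  set τ : Measure ℝ := volume.restrict (Set.Ioo 0 1)
  have : IsProbabilityMeasure τ := ⟨by simp [τ]⟩
  have hτ : ∀ᵐ t ∂τ, t ∈ Set.Icc (0 : ℝ) 1 :=
    (ae_restrict_mem measurableSet_Ioo).mono fun _ ht => Set.Ioo_subset_Icc_self ht
  have hm : AEMeasurable (fun q : ℝ × Ω => f' q.1 q.2) (τ.prod P) :=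
    aemeasurable_uncurry_of_hasDerivAt zero_le_one hf hder
  have hbound : ∫⁻ q, ENNReal.ofReal (Real.exp (f' q.1 q.2)) ∂(τ.prod P) ≤ M :=
    lintegral_prod_le_of_ae_le hm.exp.ennreal_ofReal (hτ.mono hpos)
  have hexp : Integrable (fun q : ℝ × Ω => Real.exp (f' q.1 q.2)) (τ.prod P) :=
    integrable_exp_of_lintegral_le hm hM hbound
  have hexp_neg : Integrable (fun q : ℝ × Ω => Real.exp (-f' q.1 q.2)) (τ.prod P) :=
    integrable_exp_of_lintegral_le hm.neg hM
      (lintegral_prod_le_of_ae_le hm.neg.exp.ennreal_ofReal (hτ.mono hneg))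
  have hint : Integrable (fun q : ℝ × Ω => f' q.1 q.2) (τ.prod P) := by
    simpa only [pow_one] using integrable_pow_of_integrable_exp_mul one_ne_zero
      (by simpa only [one_mul] using hexp) (by simpa only [neg_one_mul] using hexp_neg) 1
  have hjensen : ∀ᵐ ω ∂P, ENNReal.ofReal (Real.exp (f 1 ω - f 0 ω)) ≤
      ∫⁻ t, ENNReal.ofReal (Real.exp (f' t ω)) ∂τ := by
    filter_upwards [hint.prod_left_ae, hexp.prod_left_ae] with ω hω hexpω
    have hftc : ∫ t, f' t ω ∂τ = f 1 ω - f 0 ω := by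
      rw [← integral_Ioc_eq_integral_Ioo, ← intervalIntegral.integral_of_le zero_le_one]
      refine intervalIntegral.integral_eq_sub_of_hasDerivAt (f := fun s => f s ω)
        (by rw [Set.uIcc_of_le zero_le_one]; exact hder ω) ?_
      rwa [intervalIntegrable_iff_integrableOn_Ioo_of_le zero_le_one]
    rw [← hftc, ← ofReal_integral_eq_lintegral_ofReal hexpω
      (ae_of_all _ fun _ => (Real.exp_pos _).le)]
    exact ENNReal.ofReal_le_ofReal (convexOn_exp.map_integral_le Real.continuous_exp.continuousOn
      isClosed_univ (ae_of_all _ fun _ => Set.mem_univ _) hω hexpω)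
  calc ∫⁻ ω, ENNReal.ofReal (Real.exp (f 1 ω - f 0 ω)) ∂P
      ≤ ∫⁻ ω, ∫⁻ t, ENNReal.ofReal (Real.exp (f' t ω)) ∂τ ∂P := lintegral_mono_ae hjensen
    _ = ∫⁻ q, ENNReal.ofReal (Real.exp (f' q.1 q.2)) ∂(τ.prod P) :=
        (lintegral_prod_symm _ hm.exp.ennreal_ofReal).symm
    _ ≤ M := hbound

variable {E F : Type*} [NormedAddCommGroup E] [InnerProductSpace ℝ E] [CompleteSpace E]
  [NormedAddCommGroup F] [NormedSpace ℝ F] {B : Set E}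

theorem hasDerivAt_comp_add_smul {f : E → ℝ} {f' : E} {b v : E} {s : ℝ}
    (hf : HasGradientAt f f' (b + s • v)) :
    HasDerivAt (fun t : ℝ => f (b + t • v)) ⟪v, f'⟫ s := by
  have hline : HasDerivAt (fun t : ℝ => b + t • v) v s := by
    simpa only [id_eq, one_smul] using ((hasDerivAt_id s).smul_const v).const_add b
  simpa only [Function.comp_def, InnerProductSpace.toDual_apply_apply, real_inner_comm] using
    hf.hasFDerivAt.comp_hasDerivAt s hline

theorem subgaussianField_of_hasGradientAt [IsProbabilityMeasure P] (hB : Convex ℝ B)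
    {A : E →L[ℝ] F} (hA : Function.Injective A) {g : ℝ} {W : E → Ω → ℝ} {G : E → Ω → E}
    (hG : ∀ ω, ∀ a ∈ B, HasGradientAt (W · ω) (G a ω) a) (hWm : ∀ a ∈ B, Measurable (W a))
    (hexp : ∀ a ∈ B, ∀ γ : E, γ ≠ 0 → ∀ t : ℝ, |t| ≤ g →
      ∫⁻ ω, ENNReal.ofReal (Real.exp (t * (⟪γ, G a ω⟫ / ‖A γ‖))) ∂P ≤
        ENNReal.ofReal (Real.exp (t ^ 2 / 2))) :
    SubgaussianField P B A g W where
  continuousOn ω a ha := (hG ω a ha).continuousAt.continuousWithinAt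
  measurable := hWm
  lintegral_exp_le a ha b hb t ht htg := by
    rcases eq_or_ne a b with rfl | hab
    · simp
    have hab' : a - b ≠ 0 := sub_ne_zero.2 hab
    have hAab : 0 < ‖A (a - b)‖ := norm_pos_iff.2 ((map_ne_zero_iff A hA).2 hab')
    have habs : |t * ‖A (a - b)‖| ≤ g := by rwa [abs_of_pos (by positivity)]
    have hmem {s : ℝ} (hs : s ∈ Set.Icc (0 : ℝ) 1) : b + s • (a - b) ∈ B :=
      hB.add_smul_sub_mem hb ha hs
    have hscale (y : ℝ) : t * ‖A (a - b)‖ * (y / ‖A (a - b)‖) = t * y := by field_simp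
    have hsegment := lintegral_exp_sub_le_of_hasDerivAt (P := P)
      (f := fun s ω => t * W (b + s • (a - b)) ω)
      (f' := fun s ω => t * ⟪a - b, G (b + s • (a - b)) ω⟫)
      (fun s hs => (hWm _ (hmem hs)).const_mul t)
      (fun ω s hs => (hasDerivAt_comp_add_smul (hG ω _ (hmem hs))).const_mul t)
      ENNReal.ofReal_ne_top
      (fun s hs => by simpa only [hscale] using hexp _ (hmem hs) _ hab' _ habs)
      (fun s hs => by
        simpa only [neg_mul, hscale, neg_sq] using
          hexp _ (hmem hs) _ hab' (-(t * ‖A (a - b)‖)) (by rwa [abs_neg]))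
    simpa only [one_smul, zero_smul, add_zero, add_sub_cancel, mul_sub] using hsegment

end Gradient

section Linearization

variable {E : Type*} [NormedAddCommGroup E] [InnerProductSpace ℝ E] [CompleteSpace E]

/-- The remainder at `x` of the first-order Taylor expansion of `f` at `o`. -/
noncomputable def taylorRemainder (f : E → ℝ) (o x : E) : ℝ :=
  f x - f o - ⟪x - o, gradient f o⟫

theorem taylorRemainder_self (f : E → ℝ) (o : E) : taylorRemainder f o o = 0 := by
  simp only [taylorRemainder, sub_self, inner_zero_left]

theorem hasGradientAt_taylorRemainder {f : E → ℝ} {x : E} (hf : DifferentiableAt ℝ f x) (o : E) :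
    HasGradientAt (taylorRemainder f o) (gradient f x - gradient f o) x := by
  have hlin : HasFDerivAt (fun y => ⟪y - o, gradient f o⟫)
      (InnerProductSpace.toDual ℝ E (gradient f o)) x := by
    simp_rw [real_inner_comm (gradient f o), inner_sub_right]
    exact (InnerProductSpace.toDual ℝ E (gradient f o)).hasFDerivAt.sub_const _
  rw [hasGradientAt_iff_hasFDerivAt, map_sub]
  exact (hf.hasGradientAt.hasFDerivAt.sub_const _).sub hlin

variable {Ω : Type*} [MeasurableSpace Ω] {B : Set E} {Y : E → Ω → ℝ}

theorem measurable_taylorRemainder (hB : Convex ℝ B) (hY : ∀ x ∈ B, Measurable (Y x)) {o x : E}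
    (ho : o ∈ B) (hx : x ∈ B) (hdiff : ∀ ω, DifferentiableAt ℝ (Y · ω) o) :
    Measurable fun ω => taylorRemainder (Y · ω) o x := by
  have hinner : Measurable fun ω => ⟪x - o, gradient (Y · ω) o⟫ := by
    refine measurable_of_hasDerivWithinAt_Ioi (f := fun t => Y (o + t • (x - o))) zero_lt_one
      (fun t ht => hY _ (hB.add_smul_sub_mem ho hx (Set.Ico_subset_Icc_self ht))) fun ω => ?_
    refine (hasDerivAt_comp_add_smul (f := (Y · ω)) ?_).hasDerivWithinAt
    rw [zero_smul, add_zero]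
    exact (hdiff ω).hasGradientAt
  exact ((hY x hx).sub (hY o ho)).sub hinner

end Linearization

section Matrices

variable {p : ℕ}

theorem app_mul (A B : Matrix (Fin p) (Fin p) ℝ) (h : Param p) :
    app (A * B) h = app A (app B h) := by
  simp [app]

theorem inner_app_right {A : Matrix (Fin p) (Fin p) ℝ} (hA : A.IsHermitian) (x y : Param p) :
    ⟪x, app A y⟫ = ⟪app A x, y⟫ :=
  ((Matrix.isSymmetric_toEuclideanLin_iff.2 hA) x y).symm

theorem norm_app_sq {A : Matrix (Fin p) (Fin p) ℝ} (hA : A.IsHermitian) (h : Param p) :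
    ‖app A h‖ ^ 2 = ⟪h, app (A * A) h⟫ := by
  rw [app_mul, inner_app_right hA, real_inner_self_eq_norm_sq]

theorem app_inv_app {A : Matrix (Fin p) (Fin p) ℝ} (hA : IsUnit A) (h : Param p) :
    app A⁻¹ (app A h) = h := by
  rw [← app_mul, Matrix.nonsing_inv_mul A ((Matrix.isUnit_iff_isUnit_det A).1 hA)]
  simp [app]

theorem toEuclideanCLM_injective_of_isUnit {A : Matrix (Fin p) (Fin p) ℝ} (hA : IsUnit A) :
    Function.Injective (Matrix.toEuclideanCLM (𝕜 := ℝ) A) :=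
  Function.LeftInverse.injective (g := app A⁻¹) (app_inv_app hA)

theorem posDef_mul_self {A : Matrix (Fin p) (Fin p) ℝ} (hA : A.PosDef) : (A * A).PosDef := by
  simpa only [hA.1.eq] using
    Matrix.PosDef.conjTranspose_mul_self A (Matrix.mulVec_injective_iff_isUnit.2 hA.isUnit)

variable {D V : Matrix (Fin p) (Fin p) ℝ} {δ w : ℝ}

theorem isHermitian_Deps : (Deps D V δ w).IsHermitian :=
  (Matrix.nonneg_iff_posSemidef.1 (CFC.sqrt_nonneg (DepsSq D V δ w))).1

theorem Deps_mul_Deps (h : (DepsSq D V δ w).PosSemidef) :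
    Deps D V δ w * Deps D V δ w = DepsSq D V δ w :=
  CFC.sqrt_mul_sqrt_self _ h.nonneg

theorem norm_app_Deps_sq (hD : D.IsHermitian) (hV : V.IsHermitian)
    (h : (DepsSq D V δ w).PosSemidef) (x : Param p) :
    ‖app (Deps D V δ w) x‖ ^ 2 = (1 - δ) * ‖app D x‖ ^ 2 - w * ‖app V x‖ ^ 2 := by
  rw [norm_app_sq isHermitian_Deps, Deps_mul_Deps h, norm_app_sq hD, norm_app_sq hV]
  simp [app, DepsSq, inner_sub_right, inner_smul_right]

theorem posDef_DepsSq_neg (hD : D.PosDef) (hV : V.PosDef) (hδ : 0 ≤ δ) (hw : 0 < w) :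
    (DepsSq D V (-δ) (-w)).PosDef := by
  have hsum : DepsSq D V (-δ) (-w) = (1 + δ) • (D * D) + w • (V * V) := by
    simp [DepsSq]
  rw [hsum]
  exact ((posDef_mul_self hD).smul (by linarith)).add ((posDef_mul_self hV).smul hw)

theorem isUnit_Deps (h : (DepsSq D V δ w).PosDef) : IsUnit (Deps D V δ w) := by
  have hmul : IsUnit (Deps D V δ w * Deps D V δ w) := by
    rw [Deps_mul_Deps h.posSemidef]
    exact h.isUnit
  exact isUnit_of_mul_isUnit_left hmul

theorem quadProc_eq_inner_xi {Ω : Type*} {L : Param p → Ω → ℝ} (h : (DepsSq D V δ w).PosDef)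
    (θ θs : Param p) (ω : Ω) :
    quadProc L D V δ w θ θs ω = ⟪xi L D V δ w θs ω, app (Deps D V δ w) (θ - θs)⟫ -
      ‖app (Deps D V δ w) (θ - θs)‖ ^ 2 / 2 := by
  unfold quadProc xi
  rw [← inner_app_right isHermitian_Deps.inv, app_inv_app (isUnit_Deps h), real_inner_comm]

end Matrices

section LocalSet

variable {p : ℕ} {Θ : Set (Param p)} {θs : Param p} {V : Matrix (Fin p) (Fin p) ℝ} {r : ℝ}

theorem localSet_mem_nhds (hθs : θs ∈ interior Θ) (hr : 0 < r) : localSet Θ θs V r ∈ 𝓝 θs := by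
  have hcont : Continuous fun θ => ‖app V (θ - θs)‖ := by
    unfold app
    fun_prop
  have hlt : ∀ᶠ θ in 𝓝 θs, ‖app V (θ - θs)‖ < r :=
    hcont.continuousAt.eventually (gt_mem_nhds (by simpa [app] using hr))
  filter_upwards [mem_interior_iff_mem_nhds.1 hθs, hlt] with θ hθ hθr using ⟨hθ, hθr.le⟩

theorem isBounded_localSet (hV : IsUnit V) : Bornology.IsBounded (localSet Θ θs V r) := by
  refine (Metric.isBounded_closedBall (x := θs)
    (r := ‖Matrix.toEuclideanCLM (𝕜 := ℝ) V⁻¹‖ * r)).subset fun θ hθ => mem_closedBall_iff_norm.2 ?_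
  calc ‖θ - θs‖ = ‖app V⁻¹ (app V (θ - θs))‖ := by rw [app_inv_app hV]
    _ ≤ ‖Matrix.toEuclideanCLM (𝕜 := ℝ) V⁻¹‖ * ‖app V (θ - θs)‖ :=
        ContinuousLinearMap.le_opNorm _ _
    _ ≤ ‖Matrix.toEuclideanCLM (𝕜 := ℝ) V⁻¹‖ * r := by
        gcongr
        exact hθ.2

end LocalSet

section MeanLogLikelihood

variable {p : ℕ} {Ω : Type*} [MeasurableSpace Ω] {P : Measure Ω} {Θ : Set (Param p)}
  {θs θ : Param p} {L : Param p → Ω → ℝ} {V D : Matrix (Fin p) (Fin p) ℝ} {r rs δ : ℝ}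
  {δr : ℝ → ℝ}

theorem integral_llr (hint : ∀ θ ∈ Θ, Integrable (L θ) P) (hθ : θ ∈ Θ) (hθs : θs ∈ Θ) :
    ∫ ω, llr L θ θs ω ∂P = meanL P L θ - meanL P L θs :=
  integral_sub (hint θ hθ) (hint θs hθs)

theorem norm_app_sub_sq_pos (hD : IsUnit D) (hθ : θ ≠ θs) : 0 < ‖app D (θ - θs)‖ ^ 2 :=
  pow_pos (norm_pos_iff.2 ((map_ne_zero_iff _ (toEuclideanCLM_injective_of_isUnit hD)).2
    (sub_ne_zero.2 hθ))) 2

theorem CondL0.neg_two_mul_integral_llr_mem_Icc (hL0 : CondL0 P Θ θs L V D rs δr) (hD : IsUnit D)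
    (hr : 0 < r) (hrs : r ≤ rs) (hδ : δr r ≤ δ) (hθ : θ ∈ localSet Θ θs V r) :
    -2 * ∫ ω, llr L θ θs ω ∂P ∈
      Set.Icc ((1 - δ) * ‖app D (θ - θs)‖ ^ 2) ((1 + δ) * ‖app D (θ - θs)‖ ^ 2) := by
  rcases eq_or_ne θ θs with rfl | hne
  · simp [llr, app]
  · have hpos := norm_app_sub_sq_pos hD hne
    obtain ⟨hlow, hupp⟩ := abs_le.1 (((hL0 r hr hrs).2 θ hθ hne).trans hδ)
    rw [Set.mem_Icc, ← le_div_iff₀ hpos, ← div_le_iff₀ hpos]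
    constructor <;> linarith

theorem CondL0.nonneg [Nonempty (Fin p)] (hL0 : CondL0 P Θ θs L V D rs δr)
    (hθs : θs ∈ interior Θ) (hr : 0 < r) (hrs : r ≤ rs) : 0 ≤ δr r := by
  have hmem : ∀ᶠ θ in 𝓝[≠] θs, θ ∈ localSet Θ θs V r :=
    nhdsWithin_le_nhds (localSet_mem_nhds hθs hr)
  obtain ⟨θ, hθ, hne⟩ := (hmem.and self_mem_nhdsWithin).exists
  exact (abs_nonneg _).trans ((hL0 r hr hrs).2 θ hθ hne)

theorem CondL0.hasFDerivAt_meanL (hL0 : CondL0 P Θ θs L V D rs δr) (hθs : θs ∈ interior Θ)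
    (hint : ∀ θ ∈ Θ, Integrable (L θ) P) (hD : IsUnit D) (hr : 0 < r) (hrs : r ≤ rs) :
    HasFDerivAt (meanL P L) (0 : Param p →L[ℝ] ℝ) θs := by
  have hquad : (fun θ => meanL P L θ - meanL P L θs) =O[𝓝 θs] fun θ => ‖θ - θs‖ ^ 2 := by
    refine Asymptotics.IsBigO.of_bound (‖Matrix.toEuclideanCLM (𝕜 := ℝ) D‖ ^ 2) ?_
    filter_upwards [localSet_mem_nhds (V := V) hθs hr] with θ hθ
    obtain ⟨hlow, hupp⟩ := hL0.neg_two_mul_integral_llr_mem_Icc hD hr hrs (hL0 r hr hrs).1 hθ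
    rw [integral_llr hint hθ.1 (interior_subset hθs)] at hlow hupp
    have hnorm : ‖app D (θ - θs)‖ ^ 2 ≤
        ‖Matrix.toEuclideanCLM (𝕜 := ℝ) D‖ ^ 2 * ‖θ - θs‖ ^ 2 := by
      rw [← mul_pow]
      exact pow_le_pow_left₀ (norm_nonneg _) (ContinuousLinearMap.le_opNorm _ _) 2
    rw [Real.norm_eq_abs, norm_pow, norm_norm, abs_le]
    constructor <;> linarith [sq_nonneg ‖app D (θ - θs)‖]
  simpa only [sub_add_cancel] using (hquad.hasFDerivAt one_lt_two).add_const (meanL P L θs)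

theorem gradL_eq_gradZeta (hmean : HasFDerivAt (meanL P L) (0 : Param p →L[ℝ] ℝ) θ) {ω : Ω}
    (hdiff : DifferentiableAt ℝ (zeta P L · ω) θ) : gradL L θ ω = gradZeta P L θ ω := by
  have hL : (L · ω) = (zeta P L · ω) + meanL P L := by
    ext θ'
    simp only [zeta, Pi.add_apply, sub_add_cancel]
  have hgrad := hdiff.hasGradientAt.hasFDerivAt.add hmean
  rw [add_zero, ← hL] at hgrad
  exact (hasGradientAt_iff_hasFDerivAt.2 hgrad).gradient

end MeanLogLikelihood

section StochasticComponent

variable {p : ℕ} {Ω : Type*} [MeasurableSpace Ω] {P : Measure Ω} {Θ : Set (Param p)}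
  {θs : Param p} {L : Param p → Ω → ℝ} {V : Matrix (Fin p) (Fin p) ℝ} {ν g r rs : ℝ} {ρ : ℝ → ℝ}

theorem CondED1.lintegral_exp_le [NeZero P] (hED1 : CondED1 P Θ θs L V ν g rs ρ) (hν : 0 < ν)
    (hr : 0 < r) (hrs : r ≤ rs) {θ : Param p} (hθ : θ ∈ localSet Θ θs V r) {γ : Param p}
    (hγ : γ ≠ 0) {t : ℝ} (ht : |t| ≤ g * ν) :
    ∫⁻ ω, ENNReal.ofReal (Real.exp
        (t / ν * (⟪γ, gradZeta P L θ ω - gradZeta P L θs ω⟫ / (ρ r * ‖app V γ‖)))) ∂P ≤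
      ENNReal.ofReal (Real.exp (t ^ 2 / 2)) := by
  have htν : |t / ν| ≤ g := by rwa [abs_div, abs_of_pos hν, div_le_iff₀ hν]
  obtain ⟨hint, hcgf⟩ := (hED1 r hr hrs).2.2 θ hθ γ hγ (t / ν) htν
  rw [← ofReal_integral_eq_lintegral_ofReal hint (ae_of_all _ fun _ => (Real.exp_pos _).le)]
  refine ENNReal.ofReal_le_ofReal ((exp_cgf hint).symm.le.trans (Real.exp_le_exp.2 ?_))
  refine hcgf.trans_eq ?_
  field_simp

theorem CondED1.subgaussianField [IsProbabilityMeasure P]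
    (hED1 : CondED1 P Θ θs L V ν g rs ρ) (hmeas : ∀ θ ∈ Θ, Measurable (L θ)) (hV : IsUnit V)
    (hν : 0 < ν) (hr : 0 < r) (hrs : r ≤ rs) (hconv : Convex ℝ (localSet Θ θs V r))
    (hθs : θs ∈ localSet Θ θs V r)
    (hdiff : ∀ ω, ∀ θ ∈ localSet Θ θs V r, DifferentiableAt ℝ (zeta P L · ω) θ) :
    SubgaussianField P (localSet Θ θs V r) (Matrix.toEuclideanCLM (𝕜 := ℝ) V) (g * ν)
      fun θ ω => (ν * ρ r)⁻¹ * taylorRemainder (zeta P L · ω) θs θ := by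
  refine subgaussianField_of_hasGradientAt hconv (toEuclideanCLM_injective_of_isUnit hV)
    (G := fun θ ω => (ν * ρ r)⁻¹ • (gradZeta P L θ ω - gradZeta P L θs ω)) (fun ω θ hθ => ?_)
    (fun θ hθ => (measurable_taylorRemainder hconv (fun x hx => (hmeas x hx.1).sub_const _) hθs hθ
      fun ω => hdiff ω θs hθs).const_mul _) fun θ hθ γ hγ t ht => ?_
  · rw [hasGradientAt_iff_hasFDerivAt, map_smul]
    exact (hasGradientAt_taylorRemainder (hdiff ω θ hθ) θs).hasFDerivAt.const_mul _
  · convert hED1.lintegral_exp_le hν hr hrs hθ hγ ht using 5 with ω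
    change t * (_ / ‖app V γ‖) = _
    rw [real_inner_smul_right]
    field_simp

end StochasticComponent

section QuadraticBracketing

variable {p : ℕ} {Ω : Type*} [MeasurableSpace Ω] {P : Measure Ω} {Θ : Set (Param p)}
  {θs θ : Param p} {L : Param p → Ω → ℝ} {V D : Matrix (Fin p) (Fin p) ℝ} {r rs δ w : ℝ}
  {δr : ℝ → ℝ} {ω : Ω}

theorem llr_sub_eq_taylorRemainder (hint : ∀ θ ∈ Θ, Integrable (L θ) P)
    (hgrad : gradL L θs ω = gradZeta P L θs ω) (hθ : θ ∈ Θ) (hθs : θs ∈ Θ) :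
    llr L θ θs ω - ∫ ω', llr L θ θs ω' ∂P - ⟪θ - θs, gradL L θs ω⟫ =
      taylorRemainder (zeta P L · ω) θs θ := by
  rw [integral_llr hint hθ hθs, hgrad]
  simp only [llr, taylorRemainder, zeta, gradZeta]
  ring

theorem errUpper_eq_penalizedSup (hint : ∀ θ ∈ Θ, Integrable (L θ) P)
    (hgrad : gradL L θs ω = gradZeta P L θs ω) (hθs : θs ∈ Θ) :
    errUpper P Θ θs L V w r ω = penalizedSup (localSet Θ θs V r)
      (Matrix.toEuclideanCLM (𝕜 := ℝ) V) θs w (taylorRemainder (zeta P L · ω) θs ·) :=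
  biSup_congr fun θ hθ => by
    rw [llr_sub_eq_taylorRemainder hint hgrad hθ.1 hθs, app]

theorem errLower_eq_penalizedSup (hint : ∀ θ ∈ Θ, Integrable (L θ) P)
    (hgrad : gradL L θs ω = gradZeta P L θs ω) (hθs : θs ∈ Θ) :
    errLower P Θ θs L V w r ω = penalizedSup (localSet Θ θs V r)
      (Matrix.toEuclideanCLM (𝕜 := ℝ) V) θs w (-taylorRemainder (zeta P L · ω) θs ·) :=
  biSup_congr fun θ hθ => by
    rw [llr_sub_eq_taylorRemainder hint hgrad hθ.1 hθs, app]

theorem coe_le_coe_add_of_coe_sub_le {a b : ℝ} {c : EReal} (h : ((a - b : ℝ) : EReal) ≤ c) :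
    (a : EReal) ≤ b + c := by
  rwa [EReal.coe_sub, EReal.sub_le_iff_le_add (by simp) (by simp), add_comm] at h

theorem CondL0.llr_le_quadProc_add_errUpper (hL0 : CondL0 P Θ θs L V D rs δr) (hD : D.PosDef)
    (hV : V.IsHermitian) (hr : 0 < r) (hrs : r ≤ rs) (hδ : δr r ≤ δ)
    (hpos : (DepsSq D V δ w).PosSemidef) (hθ : θ ∈ localSet Θ θs V r) :
    (llr L θ θs ω : EReal) ≤ quadProc L D V δ w θ θs ω + errUpper P Θ θs L V w r ω := by
  have hmean := (hL0.neg_two_mul_integral_llr_mem_Icc hD.isUnit hr hrs hδ hθ).1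
  refine coe_le_coe_add_of_coe_sub_le (le_iSup₂_of_le θ hθ (EReal.coe_le_coe_iff.2 ?_))
  rw [quadProc, norm_app_Deps_sq hD.1 hV hpos]
  linarith

theorem CondL0.quadProc_sub_errLower_le_llr (hL0 : CondL0 P Θ θs L V D rs δr) (hD : D.PosDef)
    (hV : V.IsHermitian) (hr : 0 < r) (hrs : r ≤ rs) (hδ : δr r ≤ δ)
    (hpos : (DepsSq D V (-δ) (-w)).PosSemidef) (hθ : θ ∈ localSet Θ θs V r) :
    quadProc L D V (-δ) (-w) θ θs ω - errLower P Θ θs L V w r ω ≤ (llr L θ θs ω : EReal) := by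
  have hmean := (hL0.neg_two_mul_integral_llr_mem_Icc hD.isUnit hr hrs hδ hθ).2
  refine EReal.sub_le_of_le_add (coe_le_coe_add_of_coe_sub_le
    (le_iSup₂_of_le θ hθ (EReal.coe_le_coe_iff.2 ?_)))
  rw [quadProc, norm_app_Deps_sq hD.1 hV hpos]
  linarith

theorem errUpper_nonneg (hθs : θs ∈ localSet Θ θs V r) : 0 ≤ errUpper P Θ θs L V w r ω :=
  le_iSup₂_of_le θs hθs (by simp [llr, app])

theorem errLower_nonneg (hθs : θs ∈ localSet Θ θs V r) : 0 ≤ errLower P Θ θs L V w r ω :=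
  le_iSup₂_of_le θs hθs (by simp [llr, app])

end QuadraticBracketing

section ErrorBounds

variable {p : ℕ} {Ω : Type*} [MeasurableSpace Ω] {P : Measure Ω} [IsProbabilityMeasure P]
  {Θ : Set (Param p)} {θs : Param p} {L : Param p → Ω → ℝ} {V : Matrix (Fin p) (Fin p) ℝ}
  {ν g r rs w : ℝ} {ρ : ℝ → ℝ}

theorem CondED1.ae_errUpper_errLower_lt_top (hED1 : CondED1 P Θ θs L V ν g rs ρ)
    (hmeas : ∀ θ ∈ Θ, Measurable (L θ)) (hint : ∀ θ ∈ Θ, Integrable (L θ) P) (hV : IsUnit V)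
    (hν : 0 < ν) (hg : 0 < g) (hr : 0 < r) (hrs : r ≤ rs) (hconv : Convex ℝ (localSet Θ θs V r))
    (hθs : θs ∈ interior Θ)
    (hdiff : ∀ ω, ∀ θ ∈ localSet Θ θs V r, DifferentiableAt ℝ (zeta P L · ω) θ)
    (hgrad : ∀ ω, gradL L θs ω = gradZeta P L θs ω) (hw : 0 ≤ w) :
    ∀ᵐ ω ∂P, errUpper P Θ θs L V w r ω < ⊤ ∧ errLower P Θ θs L V w r ω < ⊤ := by
  have hnhds := localSet_mem_nhds (V := V) hθs hr
  have hcentre := mem_interior_iff_mem_nhds.2 hnhds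
  have hc : 0 < ν * ρ r := mul_pos hν (hED1 r hr hrs).1
  have hfield := hED1.subgaussianField hmeas hV hν hr hrs hconv (mem_of_mem_nhds hnhds) hdiff
  have hfield_neg := hfield.neg
  simp only [← mul_neg] at hfield_neg
  filter_upwards [
    hfield.ae_penalizedSup_lt_top hc (isBounded_localSet hV) hconv hcentre
      (fun _ => taylorRemainder_self _ _) (mul_pos hg hν) hw,
    hfield_neg.ae_penalizedSup_lt_top hc (isBounded_localSet hV) hconv hcentre
      (fun _ => neg_eq_zero.2 (taylorRemainder_self _ _)) (mul_pos hg hν) hw] with ω hupp hlow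
  rw [errUpper_eq_penalizedSup hint (hgrad ω) (interior_subset hθs),
    errLower_eq_penalizedSup hint (hgrad ω) (interior_subset hθs)]
  exact ⟨hupp, hlow⟩

theorem CondED1.measure_zQ_le_errUpper_errLower_le (hED1 : CondED1 P Θ θs L V ν g rs ρ)
    (hmeas : ∀ θ ∈ Θ, Measurable (L θ)) (hint : ∀ θ ∈ Θ, Integrable (L θ) P) (hV : IsUnit V)
    (hν : 0 < ν) (hr : 0 < r) (hrs : r ≤ rs) (hconv : Convex ℝ (localSet Θ θs V r))
    (hθs : θs ∈ interior Θ)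
    (hdiff : ∀ ω, ∀ θ ∈ localSet Θ θs V r, DifferentiableAt ℝ (zeta P L · ω) θ)
    (hgrad : ∀ ω, gradL L θs ω = gradZeta P L θs ω) (hp : 0 < p) (hw : 3 * ν * ρ r ≤ w)
    (hg : 3 ≤ g * ν) {x : ℝ} (hx : 0 ≤ x) :
    P {ω | (zQ (g * ν) x (entropyConst p) : EReal) ≤
        ((w⁻¹ : ℝ) : EReal) * errUpper P Θ θs L V w r ω} ≤ ENNReal.ofReal (Real.exp (-x)) ∧
      P {ω | (zQ (g * ν) x (entropyConst p) : EReal) ≤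
        ((w⁻¹ : ℝ) : EReal) * errLower P Θ θs L V w r ω} ≤ ENNReal.ofReal (Real.exp (-x)) := by
  have hnhds := localSet_mem_nhds (V := V) hθs hr
  have hcentre := mem_interior_iff_mem_nhds.2 hnhds
  have hc : 0 < ν * ρ r := mul_pos hν (hED1 r hr hrs).1
  have hfield := hED1.subgaussianField hmeas hV hν hr hrs hconv (mem_of_mem_nhds hnhds) hdiff
  have hfield_neg := hfield.neg
  simp only [← mul_neg] at hfield_neg
  have hdim : Module.finrank ℝ (Param p) = p := finrank_euclideanSpace_fin
  have htail {Z : Param p → Ω → ℝ} (hZ : SubgaussianField P (localSet Θ θs V r)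
      (Matrix.toEuclideanCLM (𝕜 := ℝ) V) (g * ν) fun θ ω => (ν * ρ r)⁻¹ * Z θ ω)
      (hZo : ∀ ω, Z θs ω = 0) := hZ.measure_zQ_le_penalizedSup_le hc (isBounded_localSet hV) hconv
    hcentre hZo (toEuclideanCLM_injective_of_isUnit hV) (hp.trans_eq hdim.symm) hg
    ((mul_assoc 3 ν (ρ r)).ge.trans hw) hx
  simp only [hdim] at htail
  simp only [errUpper_eq_penalizedSup hint (hgrad _) (interior_subset hθs),
    errLower_eq_penalizedSup hint (hgrad _) (interior_subset hθs)]
  exact ⟨htail hfield fun _ => taylorRemainder_self _ _,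
    htail hfield_neg fun _ => neg_eq_zero.2 (taylorRemainder_self _ _)⟩

end ErrorBounds

end Bracketing

theorem theorem3p1 {p : ℕ} (hp : 0 < p)
    {Ω : Type*} [MeasurableSpace Ω] (P : Measure Ω) [IsProbabilityMeasure P]
    -- the parameter set, the central point and the quasi-log-likelihood process
    (Θ : Set (Bracketing.Param p)) (θs : Bracketing.Param p) (hθs : θs ∈ interior Θ)
    (L : Bracketing.Param p → Ω → ℝ)
    (hmeas : ∀ θ ∈ Θ, Measurable (L θ)) (hint : ∀ θ ∈ Θ, Integrable (L θ) P)
    -- the matrices of the local geometry and the constants of the conditions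
    (V D : Matrix (Fin p) (Fin p) ℝ) (hV : V.PosDef) (hD : D.PosDef)
    (ν g rs : ℝ) (hν : 1 ≤ ν) (hg : 0 < g) (ρ δr : ℝ → ℝ)
    (hED1 : Bracketing.CondED1 P Θ θs L V ν g rs ρ)
    (hL0 : Bracketing.CondL0 P Θ θs L V D rs δr)
    -- the local zone
    (r : ℝ) (hr : 0 < r) (hrs : r ≤ rs)
    (hconv : Convex ℝ (Bracketing.localSet Θ θs V r))
    (hdiff : ∀ ω, ∀ θ ∈ Bracketing.localSet Θ θs V r,
      DifferentiableAt ℝ (fun θ' => Bracketing.zeta P L θ' ω) θ)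
    -- the choice of `ε = (δ, w)`
    (δ w : ℝ) (hw : 3 * ν * ρ r ≤ w) (hδ : δr r ≤ δ)
    (hpos : (Bracketing.DepsSq D V δ w).PosSemidef) :
    -- the bracketing bound
    (∀ ω, ∀ θ ∈ Bracketing.localSet Θ θs V r,
      (Bracketing.quadProc L D V (-δ) (-w) θ θs ω : EReal)
          - Bracketing.errLower P Θ θs L V w r ω
        ≤ (Bracketing.llr L θ θs ω : EReal) ∧
      (Bracketing.llr L θ θs ω : EReal)
        ≤ (Bracketing.quadProc L D V δ w θ θs ω : EReal)
          + Bracketing.errUpper P Θ θs L V w r ω) ∧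
    -- the linear Gaussian structure of the two bracketing processes
    ((Bracketing.DepsSq D V δ w).PosDef → ∀ ω θ,
      Bracketing.quadProc L D V δ w θ θs ω
        = ⟪Bracketing.xi L D V δ w θs ω,
            Bracketing.app (Bracketing.Deps D V δ w) (θ - θs)⟫
          - ‖Bracketing.app (Bracketing.Deps D V δ w) (θ - θs)‖ ^ 2 / 2) ∧
    ((Bracketing.DepsSq D V (-δ) (-w)).PosDef ∧ ∀ ω θ,
      Bracketing.quadProc L D V (-δ) (-w) θ θs ω
        = ⟪Bracketing.xi L D V (-δ) (-w) θs ω,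
            Bracketing.app (Bracketing.Deps D V (-δ) (-w)) (θ - θs)⟫
          - ‖Bracketing.app (Bracketing.Deps D V (-δ) (-w)) (θ - θs)‖ ^ 2 / 2) ∧
    -- the errors are nonnegative, almost surely finite, with the exponential bound
    (∀ ω, 0 ≤ Bracketing.errUpper P Θ θs L V w r ω ∧
      0 ≤ Bracketing.errLower P Θ θs L V w r ω) ∧
    (∀ᵐ ω ∂P, Bracketing.errUpper P Θ θs L V w r ω < ⊤ ∧
      Bracketing.errLower P Θ θs L V w r ω < ⊤) ∧
    (3 ≤ g * ν → ∀ x : ℝ, 0 ≤ x →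
      P {ω | (Bracketing.zQ (g * ν) x (Bracketing.entropyConst p) : EReal)
          ≤ ((w⁻¹ : ℝ) : EReal) * Bracketing.errUpper P Θ θs L V w r ω}
        ≤ ENNReal.ofReal (Real.exp (-x)) ∧
      P {ω | (Bracketing.zQ (g * ν) x (Bracketing.entropyConst p) : EReal)
          ≤ ((w⁻¹ : ℝ) : EReal) * Bracketing.errLower P Θ θs L V w r ω}
        ≤ ENNReal.ofReal (Real.exp (-x))) := by
  have hν0 : 0 < ν := zero_lt_one.trans_le hν
  have hw0 : 0 < w := (mul_pos (mul_pos three_pos hν0) (hED1 r hr hrs).1).trans_le hw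
  have : Nonempty (Fin p) := ⟨⟨0, hp⟩⟩
  have hδ0 : 0 ≤ δ := (hL0.nonneg hθs hr hrs).trans hδ
  have hpos_neg := Bracketing.posDef_DepsSq_neg hD hV hδ0 hw0
  have hs : θs ∈ Bracketing.localSet Θ θs V r :=
    mem_of_mem_nhds (Bracketing.localSet_mem_nhds hθs hr)
  have hgrad : ∀ ω, Bracketing.gradL L θs ω = Bracketing.gradZeta P L θs ω := fun ω =>
    Bracketing.gradL_eq_gradZeta (hL0.hasFDerivAt_meanL hθs hint hD.isUnit hr hrs) (hdiff ω θs hs)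
  exact ⟨fun ω θ hθ =>
      ⟨hL0.quadProc_sub_errLower_le_llr hD hV.1 hr hrs hδ hpos_neg.posSemidef hθ,
        hL0.llr_le_quadProc_add_errUpper hD hV.1 hr hrs hδ hpos hθ⟩,
    fun hposDef ω θ => Bracketing.quadProc_eq_inner_xi hposDef θ θs ω,
    ⟨hpos_neg, fun ω θ => Bracketing.quadProc_eq_inner_xi hpos_neg θ θs ω⟩,
    fun ω => ⟨Bracketing.errUpper_nonneg hs, Bracketing.errLower_nonneg hs⟩,
    hED1.ae_errUpper_errLower_lt_top hmeas hint hV.isUnit hν0 hg hr hrs hconv hθs hdiff hgrad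
      hw0.le,
    fun hgν x hx => hED1.measure_zQ_le_errUpper_errLower_le hmeas hint hV.isUnit hν0 hr hrs hconv
      hθs hdiff hgrad hp hw hgν hx⟩
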